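/- Let $d \in \mathbb{N} = \{1,2,3,\dots\}$, $a \in \mathbb{R}$, $b \in (a,\infty)$, let $\|\cdot\|$ be the Euclidean norm on $\mathbb{R}^d$, let $(\Omega,\mathcal{F},\mathbb{P})$ be a probability space, let $X_{n,m}\colon \Omega \to [a,b]^d$, $(n,m)\in\mathbb{Z}^2$, be i.i.d. random variables, assume for all $x \in [a,b]^d$, $\varepsilon \in (0,1)$ that $\mathbb{P}(\|X_{0,0}-x\|<\varepsilon)>0$, and let $\ell\colon \mathbb{R}^d\times\mathbb{R}^d\to\mathbb{R}$ satisfy $\ell(\theta,x)=\|\theta-x\|^2$ for all $\theta,x\in\mathbb{R}^d$. Let $M,\mathfrak{M}\in\mathbb{N}$, and let $\Theta\colon\mathbb{N}_0\times\Omega\to\mathbb{R}^d$ and $\gamma\colon\mathbb{N}\times\Omega\to\mathbb{R}$ be stochastic processes which satisfy for all $n\in\mathbb{N}$ that $$\Theta_n=\Theta_{n-1}-\frac{\gamma_n}{M}\sum_{m=1}^{M}(\nabla_\theta \ell)(\Theta_{n-1},X_{n,m}).$$ Assume that $(X_{n,m})_{(n,m)\in\mathbb{Z}^2}$ and $\Theta_0$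 are independent and that $\mathbb{E}[\|\Theta_0\|^2]<\infty$. Let $(\nu_n)_{n\in\mathbb{N}}\subseteq(0,1)$ be strictly decreasing with $\sum_{n=1}^\infty\nu_n=\infty$ and $\lim_{n\to\infty}\nu_n=0$, and assume for all $n\in\mathbb{N}$ that $\gamma_1=\nu_1$ and $$\gamma_{n+1}=\begin{cases}\gamma_n & \colon\ \sum_{m=1}^{\mathfrak{M}}\ell(\Theta_n,X_{n,-m})\le\sum_{m=1}^{\mathfrak{M}}\ell(\Theta_{n-1},X_{n,-m}),\\[2pt] \max\bigl((0,\gamma_n)\cap\{\nu_k\colon k\in\mathbb{N}\}\bigr) & \colon\ \sum_{m=1}^{\mathfrak{M}}\ell(\Theta_n,X_{n,-m})>\sum_{m=1}^{\mathfrak{M}}\ell(\Theta_{n-1},X_{n,-m}).\end{cases}$$ For every $t\in[0,\infty)$ let $N_t=\inf\{n\in\mathbb{N}_0\colon\sum_{k=1}^n\gamma_k\ge t\}$. Then $\mathbb{E}\bigl[\|\Theta_{N_t}-\mathbb{E}[X_{1,1}]\|\bigr]<\infty$ for all $t\in[0,\infty)$, and $$\lim_{t\to\infty}\mathbb{E}\bigl[\|\Theta_{N_t}-\mathbb{E}[X_{1,1}]\|\bigr]=0.$$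 -/

import Mathlib

open MeasureTheory ProbabilityTheory Filter Topology

/-!
The gradient of `‖θ - x‖ ^ 2` is `2 (θ - x)`, so with `μ` the mean of the data, `D n = Θ n - μ` and
`ξ n` the centred mean of the training batch in row `n + 1`, the process satisfies
`D (n + 1) = (1 - 2 g n) D n + 2 g n ξ n`, where `g n = γ (n + 1)` is determined by the past. At
each step the step size is either kept or moved to the next value of `ν`, so `g n = ν (k + 1)` with `k`
the number of reductions so far (`stepSize_eq_count`). The proof has two halves.

*The step sizes tend to zero almost surely.* Suppose that the step size is eventually constant.
Then the update is eventually a fixed affine contraction towards the data. A sufficiently long run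
of training data near the corner `x = (a, …, a)` brings the iterate close to `x`; if it is followed
by a batch near the opposite corner `y`, tested against data near `x`, then the test loss increases
and the step size is reduced (`exists_block_forcing_increase`). Such patterns involve only the data,
not the iterates, and on disjoint blocks of rows they are independent with probability bounded
below. By the second Borel–Cantelli lemma infinitely many of them occur almost surely
(`ae_frequently_pattern`), a contradiction. On the other hand the step sizes are never summable
(`tendsto_sum_stepSize`): either all values of `ν` are used, or `g` is bounded below.

*Convergence at the times `N t`* (`tendsto_integral_norm_stopped`). Let `S n` be the sum of `g i`
over `i < n` and `c = 4 (1 - ν 1)`. Since `(1 - 2 g)² ≤ exp (-c g)` for `g ≤ ν 1`, the energy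
`exp (c * S n) * ‖D n‖ ^ 2` increases in one step at most by a term linear in the noise and by
a constant times `g n ^ 2 * exp (c * S (n + 1))`. The event that step `n` is made before time `N t`
is `S n < t`, which is determined by the past, so the linear terms have mean zero even when stopped
at `N t`. As `t ≤ S (N t) ≤ t + 1`, this bounds the mean of `‖D (N t)‖ ^ 2` by
`exp (-c t) * E ‖D 0‖ ^ 2` plus a constant times the mean of the discounted sum of squared step
sizes at time `N t`. That discounted sum is bounded, and it tends to zero because it is an
exponentially weighted average of the step sizes (`tendsto_discountedSqSum`); dominated convergence
finishes the proof. All integrability comes from the bound `‖D n‖ ≤ ‖D 0‖ + K / (1 - ν 1)`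
(`norm_le_of_rec`).
-/

/-! ### Pathwise estimates for the recursion -/

theorem le_pow_mul_add_of_affine_rec {v : ℕ → ℝ} {q c : ℝ} {r : ℕ} (hq0 : 0 ≤ q) (hq1 : q < 1)
    (hc : 0 ≤ c) (h : ∀ k < r, v (k + 1) ≤ q * v k + c) :
    ∀ k ≤ r, v k ≤ q ^ k * v 0 + c / (1 - q) := by
  intro k
  induction k with
  | zero =>
    intro _
    have : 0 ≤ c / (1 - q) := div_nonneg hc (by linarith)
    simpa using this
  | succ k ih =>
    intro hk
    have h1 := h k hk
    have h2 := mul_le_mul_of_nonneg_left (ih (by omega)) hq0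
    have h3 : q * (c / (1 - q)) + c = c / (1 - q) := by
      have : 1 - q ≠ 0 := by linarith
      field_simp
      ring
    calc v (k + 1) ≤ q * v k + c := h1
      _ ≤ q * (q ^ k * v 0 + c / (1 - q)) + c := by linarith
      _ = q ^ (k + 1) * v 0 + (q * (c / (1 - q)) + c) := by ring
      _ = _ := by rw [h3]

theorem abs_one_sub_two_mul_lt_one {g : ℝ} (h0 : 0 < g) (h1 : g < 1) : |1 - 2 * g| < 1 :=
  abs_lt.2 ⟨by linarith, by linarith⟩

section Recursion

variable {E : Type*} [NormedAddCommGroup E] [InnerProductSpace ℝ E]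

theorem norm_step_le (x y : E) {g : ℝ} (hg : 0 ≤ g) :
    ‖(1 - 2 * g) • x + (2 * g) • y‖ ≤ |1 - 2 * g| * ‖x‖ + 2 * g * ‖y‖ := by
  refine (norm_add_le _ _).trans (le_of_eq ?_)
  rw [norm_smul, norm_smul, Real.norm_eq_abs, Real.norm_eq_abs,
    abs_of_nonneg (by linarith : 0 ≤ 2 * g)]

/-- A step of size at most `q < 1` does not leave a ball of radius at least `K / (1 - q)`, so the
recursion driven by noise bounded by `K` is bounded uniformly in time. -/
theorem norm_le_of_rec {D ξ : ℕ → E} {g : ℕ → ℝ} {q K : ℝ} (hq : q < 1)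
    (hg0 : ∀ n, 0 < g n) (hgq : ∀ n, g n ≤ q) (hξ : ∀ n, ‖ξ n‖ ≤ K)
    (hD : ∀ n, D (n + 1) = (1 - 2 * g n) • D n + (2 * g n) • ξ n) (n : ℕ) :
    ‖D n‖ ≤ ‖D 0‖ + K / (1 - q) := by
  have hK : 0 ≤ K := (norm_nonneg _).trans (hξ 0)
  have hq0 : 0 < 1 - q := by linarith
  set r := ‖D 0‖ + K / (1 - q)
  have hr : K ≤ (1 - q) * r := by
    have h1 : (1 - q) * (K / (1 - q)) = K := by field_simp
    have h2 : 0 ≤ (1 - q) * ‖D 0‖ := by positivity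
    simp only [r, mul_add, h1]
    linarith
  have hr0 : 0 ≤ r := by positivity
  induction n with
  | zero => simp only [r]; linarith [div_nonneg hK hq0.le]
  | succ n ih =>
    have h0 := hg0 n
    have h1 := hgq n
    rw [hD]
    refine (norm_step_le _ _ h0.le).trans ?_
    have h2 := mul_le_mul_of_nonneg_left ih (abs_nonneg (1 - 2 * g n))
    have h3 := mul_le_mul_of_nonneg_left (hξ n) (by linarith : 0 ≤ 2 * g n)
    have h5 : (1 - q) * r ≤ (1 - g n) * r := mul_le_mul_of_nonneg_right (by linarith) hr0
    have h6 : (1 - q) * r ≤ r := by nlinarith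
    rcases abs_cases (1 - 2 * g n) with ⟨h4, _⟩ | ⟨h4, _⟩ <;> rw [h4] at h2 ⊢ <;> nlinarith

/-- One step of the recursion, in the squared norm and with the growth of the weight
`exp (c * S)`: the contraction `(1 - 2 g)² ≤ 1 - 4 (1 - q) g` is absorbed by the weight. -/
theorem exp_mul_norm_sq_step_le (x y : E) {g q K : ℝ} (hg0 : 0 < g) (hgq : g ≤ q)
    (hy : ‖y‖ ≤ K) :
    Real.exp (4 * (1 - q) * g) * ‖(1 - 2 * g) • x + (2 * g) • y‖ ^ 2 ≤
      ‖x‖ ^ 2 + Real.exp (4 * (1 - q) * g) *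
        (4 * g * (1 - 2 * g) * inner ℝ x y + 4 * K ^ 2 * g ^ 2) := by
  have hexp : ‖(1 - 2 * g) • x + (2 * g) • y‖ ^ 2 =
      (1 - 2 * g) ^ 2 * ‖x‖ ^ 2 + 4 * g * (1 - 2 * g) * inner ℝ x y + 4 * g ^ 2 * ‖y‖ ^ 2 := by
    rw [norm_add_sq_real, norm_smul, norm_smul, real_inner_smul_left, real_inner_smul_right,
      mul_pow, mul_pow, Real.norm_eq_abs, Real.norm_eq_abs, sq_abs, sq_abs]
    ring
  have h1 : (1 - 2 * g) ^ 2 ≤ Real.exp (-(4 * (1 - q) * g)) := by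
    have := Real.add_one_le_exp (-(4 * (1 - q) * g))
    nlinarith
  have h2 : Real.exp (4 * (1 - q) * g) * (1 - 2 * g) ^ 2 ≤ 1 := by
    calc _ ≤ Real.exp (4 * (1 - q) * g) * Real.exp (-(4 * (1 - q) * g)) := by gcongr
      _ = 1 := by rw [← Real.exp_add]; simp
  have h3 : ‖y‖ ^ 2 ≤ K ^ 2 := by gcongr
  rw [hexp]
  have h4 := mul_le_mul_of_nonneg_right h2 (sq_nonneg ‖x‖)
  have h5 : Real.exp (4 * (1 - q) * g) * (4 * g ^ 2 * ‖y‖ ^ 2) ≤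
      Real.exp (4 * (1 - q) * g) * (4 * g ^ 2 * K ^ 2) := by gcongr
  nlinarith

/-- The weighted energy after `n` steps: initial energy, cross terms with the noise, and the
accumulated second order terms. -/
theorem exp_mul_norm_sq_le_sum {D ξ : ℕ → E} {g : ℕ → ℝ} {q K : ℝ}
    (hg0 : ∀ n, 0 < g n) (hgq : ∀ n, g n ≤ q) (hξ : ∀ n, ‖ξ n‖ ≤ K)
    (hD : ∀ n, D (n + 1) = (1 - 2 * g n) • D n + (2 * g n) • ξ n) (n : ℕ) :
    Real.exp (4 * (1 - q) * ∑ i ∈ Finset.range n, g i) * ‖D n‖ ^ 2 ≤ ‖D 0‖ ^ 2 +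
      ∑ i ∈ Finset.range n, Real.exp (4 * (1 - q) * ∑ j ∈ Finset.range (i + 1), g j) *
        (4 * g i * (1 - 2 * g i) * inner ℝ (D i) (ξ i)) +
      4 * K ^ 2 * ∑ i ∈ Finset.range n,
        g i ^ 2 * Real.exp (4 * (1 - q) * ∑ j ∈ Finset.range (i + 1), g j) := by
  induction n with
  | zero => simp
  | succ n ih =>
    have h1 := exp_mul_norm_sq_step_le (D n) (ξ n) (hg0 n) (hgq n) (hξ n)
    rw [← hD] at h1
    have h2 := mul_le_mul_of_nonneg_left h1
      (Real.exp_pos (4 * (1 - q) * ∑ i ∈ Finset.range n, g i)).le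
    rw [mul_add (Real.exp _) (‖D n‖ ^ 2), ← mul_assoc, ← mul_assoc, ← Real.exp_add, ← mul_add,
      ← Finset.sum_range_succ] at h2
    rw [Finset.sum_range_succ (fun i => Real.exp _ * _) n,
      Finset.sum_range_succ (fun i => _ ^ 2 * _) n]
    linarith

end Recursion

/-! ### The discounted sum of squared step sizes -/

/-- The sum of the squared step sizes `g i ^ 2` over `i < n`, discounted exponentially at rate `c`
in the accumulated step size. -/
noncomputable def discountedSqSum (c : ℝ) (g : ℕ → ℝ) (n : ℕ) : ℝ :=
  (∑ i ∈ Finset.range n, g i ^ 2 * Real.exp (c * ∑ j ∈ Finset.range (i + 1), g j)) /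
    Real.exp (c * ∑ i ∈ Finset.range n, g i)

theorem exp_mul_discountedSqSum (c : ℝ) (g : ℕ → ℝ) (n : ℕ) :
    Real.exp (c * ∑ i ∈ Finset.range n, g i) * discountedSqSum c g n =
      ∑ i ∈ Finset.range n, g i ^ 2 * Real.exp (c * ∑ j ∈ Finset.range (i + 1), g j) :=
  mul_div_cancel₀ _ (Real.exp_pos _).ne'

theorem discountedSqSum_nonneg (c : ℝ) (g : ℕ → ℝ) (n : ℕ) : 0 ≤ discountedSqSum c g n := by
  unfold discountedSqSum
  positivity

/-- A left Riemann sum of the increasing function `exp (c * s)` is at most its integral. -/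
theorem mul_sum_mul_exp_le (c : ℝ) (g : ℕ → ℝ) (n : ℕ) :
    c * ∑ i ∈ Finset.range n, g i * Real.exp (c * ∑ j ∈ Finset.range i, g j) ≤
      Real.exp (c * ∑ i ∈ Finset.range n, g i) - 1 := by
  induction n with
  | zero => simp
  | succ n ih =>
    rw [Finset.sum_range_succ, Finset.sum_range_succ (fun i => g i), mul_add, mul_add,
      Real.exp_add]
    have h1 := Real.add_one_le_exp (c * g n)
    have h2 := mul_le_mul_of_nonneg_left h1
      (Real.exp_pos (c * ∑ i ∈ Finset.range n, g i)).le
    linarith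

theorem sq_mul_exp_le {c : ℝ} (hc : 0 ≤ c) {g : ℕ → ℝ} {δ : ℝ} (i : ℕ) (hg0 : 0 < g i)
    (hg1 : g i ≤ 1) (hδ : g i ≤ δ) :
    g i ^ 2 * Real.exp (c * ∑ j ∈ Finset.range (i + 1), g j) ≤
      δ * Real.exp c * (g i * Real.exp (c * ∑ j ∈ Finset.range i, g j)) := by
  rw [Finset.sum_range_succ, mul_add, Real.exp_add]
  have h1 : Real.exp (c * g i) ≤ Real.exp c := Real.exp_le_exp.2 (by nlinarith)
  have h2 : g i * Real.exp (c * g i) ≤ δ * Real.exp c :=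
    mul_le_mul hδ h1 (Real.exp_pos _).le (hg0.le.trans hδ)
  calc _ = g i * Real.exp (c * g i) * (g i * Real.exp (c * ∑ j ∈ Finset.range i, g j)) := by ring
    _ ≤ _ := by gcongr

theorem discountedSqSum_le {c : ℝ} (hc : 0 < c) {g : ℕ → ℝ} (hg0 : ∀ n, 0 < g n)
    (hg1 : ∀ n, g n ≤ 1) (n : ℕ) : discountedSqSum c g n ≤ Real.exp c / c := by
  rw [discountedSqSum, div_le_div_iff₀ (Real.exp_pos _) hc]
  have h1 : ∑ i ∈ Finset.range n, g i ^ 2 * Real.exp (c * ∑ j ∈ Finset.range (i + 1), g j) ≤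
      Real.exp c * ∑ i ∈ Finset.range n, g i * Real.exp (c * ∑ j ∈ Finset.range i, g j) := by
    rw [Finset.mul_sum]
    refine Finset.sum_le_sum fun i _ => ?_
    simpa using sq_mul_exp_le hc.le i (hg0 i) (hg1 i) (hg1 i)
  have h2 := mul_le_mul_of_nonneg_left (mul_sum_mul_exp_le c g n) (Real.exp_pos c).le
  have h3 := mul_le_mul_of_nonneg_right h1 hc.le
  nlinarith [Real.exp_pos c]

/-- If the step sizes tend to zero and are not summable, the discounted sum of their squares tends
to zero: it is dominated by an average of the step sizes. -/
theorem tendsto_discountedSqSum {c : ℝ} (hc : 0 < c) {g : ℕ → ℝ} (hg0 : ∀ n, 0 < g n)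
    (hg1 : ∀ n, g n ≤ 1) (hlim : Tendsto g atTop (𝓝 0))
    (hS : Tendsto (fun n => ∑ i ∈ Finset.range n, g i) atTop atTop) :
    Tendsto (discountedSqSum c g) atTop (𝓝 0) := by
  set e : ℕ → ℝ := fun i => g i * Real.exp (c * ∑ j ∈ Finset.range i, g j)
  have he0 : 0 ≤ e := fun i => mul_nonneg (hg0 i).le (Real.exp_pos _).le
  have hlittle :
      (fun i => g i ^ 2 * Real.exp (c * ∑ j ∈ Finset.range (i + 1), g j)) =o[atTop] e := by
    refine Asymptotics.isLittleO_iff.2 fun δ hδ => ?_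
    filter_upwards [hlim.eventually_le_const (show (0 : ℝ) < δ / Real.exp c by positivity)]
      with i hi
    have := sq_mul_exp_le hc.le i (hg0 i) (hg1 i) hi
    rw [div_mul_cancel₀ _ (Real.exp_pos _).ne'] at this
    rwa [Real.norm_of_nonneg (by positivity), Real.norm_of_nonneg (he0 i)]
  have hediv : Tendsto (fun n => ∑ i ∈ Finset.range n, e i) atTop atTop := by
    refine tendsto_atTop_mono (fun n => Finset.sum_le_sum fun i _ => ?_) hS
    have hS0 : 0 ≤ ∑ j ∈ Finset.range i, g j := Finset.sum_nonneg fun j _ => (hg0 j).le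
    exact le_mul_of_one_le_right (hg0 i).le (Real.one_le_exp (by positivity))
  refine ((hlittle.sum_range he0 hediv).trans_isBigO ?_).tendsto_div_nhds_zero
  refine Asymptotics.IsBigO.of_bound (1 / c) (Eventually.of_forall fun n => ?_)
  rw [Real.norm_of_nonneg (Finset.sum_nonneg fun i _ => he0 i),
    Real.norm_of_nonneg (Real.exp_pos _).le, one_div, inv_mul_eq_div, le_div_iff₀ hc]
  have := mul_sum_mul_exp_le c g n
  simp only [e]
  linarith

/-! ### Stochastic approximation with random step sizes -/

section Stopped

variable {Ω E : Type*} {mΩ : MeasurableSpace Ω} {P : Measure Ω}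
  [NormedAddCommGroup E] [InnerProductSpace ℝ E] [CompleteSpace E] [MeasurableSpace E]
  [BorelSpace E]

theorem integral_inner_eq_zero_of_indepFun {U V : Ω → E} (hUV : IndepFun U V P)
    (hU : Integrable U P) (hV : Integrable V P) (h0 : ∫ ω, V ω ∂P = 0) :
    ∫ ω, inner ℝ (U ω) (V ω) ∂P = 0 := by
  have := hUV.integral_bilin hU hV (innerSL ℝ)
  rw [h0, map_zero] at this
  exact this

theorem measurable_comp_index {β : Type*} [MeasurableSpace β] {f : ℕ → Ω → β} {N : Ω → ℕ}
    (hf : ∀ n, Measurable (f n)) (hN : Measurable N) : Measurable fun ω => f (N ω) ω := by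
  have h : Measurable fun p : Ω × ℕ => f p.2 p.1 :=
    measurable_from_prod_countable_left fun n => hf n
  exact h.comp (measurable_id.prodMk hN)

theorem integral_le_sqrt_integral_sq [IsProbabilityMeasure P] {f : Ω → ℝ} (hf : Integrable f P)
    (hf2 : Integrable (fun ω => f ω ^ 2) P) :
    ∫ ω, f ω ∂P ≤ √(∫ ω, f ω ^ 2 ∂P) := by
  refine Real.le_sqrt_of_sq_le ?_
  have h1 : 0 ≤ ∫ ω, (f ω - ∫ ω', f ω' ∂P) ^ 2 ∂P := integral_nonneg fun ω => sq_nonneg _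
  have h2 : ∀ ω, (f ω - ∫ ω', f ω' ∂P) ^ 2 =
      f ω ^ 2 - 2 * (∫ ω', f ω' ∂P) * f ω + (∫ ω', f ω' ∂P) ^ 2 := fun ω => by ring
  simp_rw [h2] at h1
  have h3 : Integrable (fun ω => 2 * (∫ ω', f ω' ∂P) * f ω) P := hf.const_mul _
  have h4 : Integrable (fun ω => f ω ^ 2 - 2 * (∫ ω', f ω' ∂P) * f ω) P := hf2.sub h3
  rw [integral_add h4 (integrable_const _), integral_sub hf2 h3, integral_const_mul] at h1
  simp at h1
  nlinarith

variable [IsProbabilityMeasure P] [SecondCountableTopology E]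
  {ℱ : Filtration ℕ mΩ} {D ξ : ℕ → Ω → E} {g : ℕ → Ω → ℝ} {q K : ℝ}

/-- Before the accumulated step size reaches `t`, the cross terms of the energy have mean zero: the
weight is predictable, and the noise is centred and independent of the past. -/
theorem integral_cross_term_eq_zero (hq : q < 1)
    (hDm : ∀ n, Measurable[ℱ n] (D n)) (hgm : ∀ n, Measurable[ℱ n] (g n))
    (hξm : ∀ n, Measurable (ξ n))
    (hind : ∀ n, Indep (ℱ n) (MeasurableSpace.comap (ξ n) inferInstance) P)
    (hg0 : ∀ n ω, 0 < g n ω) (hgq : ∀ n ω, g n ω ≤ q) (hξ : ∀ n ω, ‖ξ n ω‖ ≤ K)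
    (hξ0 : ∀ n, ∫ ω, ξ n ω ∂P = 0) (hDint : ∀ n, Integrable (D n) P) (t : ℝ) (i : ℕ) :
    Integrable (fun ω => if ∑ j ∈ Finset.range i, g j ω < t then
        Real.exp (4 * (1 - q) * ∑ j ∈ Finset.range (i + 1), g j ω) *
          (4 * g i ω * (1 - 2 * g i ω) * inner ℝ (D i ω) (ξ i ω)) else 0) P ∧
    ∫ ω, (if ∑ j ∈ Finset.range i, g j ω < t then
        Real.exp (4 * (1 - q) * ∑ j ∈ Finset.range (i + 1), g j ω) *
          (4 * g i ω * (1 - 2 * g i ω) * inner ℝ (D i ω) (ξ i ω)) else 0) ∂P = 0 := by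
  set a : Ω → ℝ := fun ω => if ∑ j ∈ Finset.range i, g j ω < t then
    Real.exp (4 * (1 - q) * ∑ j ∈ Finset.range (i + 1), g j ω) *
      (4 * g i ω * (1 - 2 * g i ω)) else 0 with ha
  have hgm' : ∀ j ≤ i, Measurable[ℱ i] (g j) := fun j hj => (hgm j).mono (ℱ.mono hj) le_rfl
  have hSm : ∀ k ≤ i + 1, Measurable[ℱ i] fun ω => ∑ j ∈ Finset.range k, g j ω := fun k hk =>
    Finset.measurable_fun_sum _ fun j hj => hgm' j (by have := Finset.mem_range.1 hj; omega)
  have ham : Measurable[ℱ i] a := by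
    have hset : MeasurableSet[ℱ i] {ω | ∑ j ∈ Finset.range i, g j ω < t} :=
      measurableSet_lt (hSm i (by omega)) measurable_const
    refine Measurable.ite hset ?_ measurable_const
    refine Measurable.mul ((hSm (i + 1) le_rfl).const_mul _).exp ?_
    exact ((hgm i).const_mul 4).mul (((hgm i).const_mul 2).const_sub 1)
  have hUm : Measurable[ℱ i] fun ω => a ω • D i ω := ham.smul (hDm i)
  have hUle : ∀ ω, ‖a ω‖ ≤ Real.exp (4 * (1 - q) * (t + 1)) * 4 := by
    intro ω
    by_cases hS : ∑ j ∈ Finset.range i, g j ω < t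
    · have h0 := hg0 i ω
      have h1 := hgq i ω
      simp only [ha, if_pos hS, norm_mul, Real.norm_eq_abs, Real.abs_exp, Finset.sum_range_succ]
      refine mul_le_mul (Real.exp_le_exp.2 ?_) ?_ (by positivity) (Real.exp_pos _).le
      · exact mul_le_mul_of_nonneg_left (by linarith) (by linarith)
      · have h2 := abs_one_sub_two_mul_lt_one h0 (h1.trans_lt hq)
        rw [abs_of_pos h0, abs_of_pos (by norm_num : (0 : ℝ) < 4)]
        nlinarith [abs_nonneg (1 - 2 * g i ω)]
    · simp only [ha, if_neg hS, norm_zero]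
      positivity
  have hUint : Integrable (fun ω => a ω • D i ω) P := by
    refine (hDint i).bdd_smul (C := Real.exp (4 * (1 - q) * (t + 1)) * 4) ?_ ?_
    · exact (ham.mono (ℱ.le i) le_rfl).aestronglyMeasurable
    · exact Eventually.of_forall hUle
  have hVint : Integrable (ξ i) P :=
    Integrable.of_bound (hξm i).aestronglyMeasurable K (Eventually.of_forall (hξ i))
  have hindep : IndepFun (fun ω => a ω • D i ω) (ξ i) P :=
    indep_of_indep_of_le_left (hind i) hUm.comap_le
  have heq : (fun ω => if ∑ j ∈ Finset.range i, g j ω < t then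
        Real.exp (4 * (1 - q) * ∑ j ∈ Finset.range (i + 1), g j ω) *
          (4 * g i ω * (1 - 2 * g i ω) * inner ℝ (D i ω) (ξ i ω)) else 0) =
      fun ω => inner ℝ (a ω • D i ω) (ξ i ω) := by
    funext ω
    rw [real_inner_smul_left]
    simp only [ha]
    split_ifs <;> ring
  rw [heq]
  exact ⟨hindep.integrable_bilin hUint hVint (innerSL ℝ),
    integral_inner_eq_zero_of_indepFun hindep hUint hVint (hξ0 i)⟩

/-- The energy bound stopped at the time `N` at which the accumulated step size reaches `t`. -/
theorem integral_norm_sq_stopped_le (hq : q < 1)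
    (hDm : ∀ n, Measurable[ℱ n] (D n)) (hgm : ∀ n, Measurable[ℱ n] (g n))
    (hξm : ∀ n, Measurable (ξ n))
    (hind : ∀ n, Indep (ℱ n) (MeasurableSpace.comap (ξ n) inferInstance) P)
    (hg0 : ∀ n ω, 0 < g n ω) (hgq : ∀ n ω, g n ω ≤ q) (hξ : ∀ n ω, ‖ξ n ω‖ ≤ K)
    (hξ0 : ∀ n, ∫ ω, ξ n ω ∂P = 0)
    (hD : ∀ n ω, D (n + 1) ω = (1 - 2 * g n ω) • D n ω + (2 * g n ω) • ξ n ω)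
    (hD0 : Integrable (fun ω => ‖D 0 ω‖ ^ 2) P)
    (hbdd : ∀ n ω, ‖D n ω‖ ≤ ‖D 0 ω‖ + K / (1 - q))
    (t : ℝ) (ht : 0 ≤ t) (N : Ω → ℕ) (hN : ∀ ω n, N ω ≤ n ↔ t ≤ ∑ i ∈ Finset.range n, g i ω)
    (hbdd_int : Integrable (fun ω => (‖D 0 ω‖ + K / (1 - q)) ^ 2) P)
    (hDint : ∀ n, Integrable (D n) P) (hNm : Measurable N) :
    ∫ ω, ‖D (N ω) ω‖ ^ 2 ∂P ≤ Real.exp (-(4 * (1 - q) * t)) * ∫ ω, ‖D 0 ω‖ ^ 2 ∂P +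
      4 * K ^ 2 * Real.exp (4 * (1 - q)) *
        ∫ ω, discountedSqSum (4 * (1 - q)) (fun n => g n ω) (N ω) ∂P := by
  set c := 4 * (1 - q) with hc_def
  have hc : 0 < c := by rw [hc_def]; linarith
  set S : ℕ → Ω → ℝ := fun n ω => ∑ i ∈ Finset.range n, g i ω with hS_def
  set u : ℕ → Ω → ℝ := fun n ω => discountedSqSum c (fun k => g k ω) n with hu_def
  set τ : ℕ → Ω → ℕ := fun n ω => min n (N ω) with hτ_def
  have hg1 : ∀ n ω, g n ω ≤ 1 := fun n ω => (hgq n ω).trans hq.le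
  have hgm' : ∀ n, Measurable (g n) := fun n => (hgm n).mono (ℱ.le n) le_rfl
  have hDm' : ∀ n, Measurable (D n) := fun n => (hDm n).mono (ℱ.le n) le_rfl
  have hSm : ∀ n, Measurable (S n) := fun n => Finset.measurable_fun_sum _ fun j _ => hgm' j
  have hum : ∀ n, Measurable (u n) := fun n => by
    simp only [hu_def, discountedSqSum]
    refine Measurable.div (Finset.measurable_fun_sum _ fun j _ => ?_) ((hSm n).const_mul c).exp
    exact ((hgm' j).pow_const 2).mul ((hSm (j + 1)).const_mul c).exp
  have hτm : ∀ n, Measurable (τ n) := fun n => measurable_const.min hNm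
  have hSle : ∀ n ω, S (τ n ω) ω ≤ t + 1 := by
    intro n ω
    rcases Nat.eq_zero_or_pos (τ n ω) with h | h
    · simp only [hS_def, h, Finset.range_zero, Finset.sum_empty]; linarith
    · obtain ⟨k, hk⟩ : ∃ k, τ n ω = k + 1 := ⟨τ n ω - 1, by omega⟩
      have hkN : k < N ω := by
        have : τ n ω ≤ N ω := min_le_right _ _
        omega
      have h1 : S k ω < t := not_le.1 fun h => absurd ((hN ω k).2 h) (by omega)
      have h2 := hg1 k ω
      simp only [hk, hS_def, Finset.sum_range_succ] at h1 ⊢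
      linarith
  -- the stopped energy and the stopped second order terms, with their bounds
  set A : ℕ → Ω → ℝ := fun n ω => Real.exp (c * S (τ n ω) ω) * ‖D (τ n ω) ω‖ ^ 2 with hA_def
  set B : ℕ → Ω → ℝ := fun n ω => Real.exp (c * S (τ n ω) ω) * u (τ n ω) ω with hB_def
  have hexple : ∀ n ω, Real.exp (c * S (τ n ω) ω) ≤ Real.exp (c * (t + 1)) := fun n ω =>
    Real.exp_le_exp.2 (mul_le_mul_of_nonneg_left (hSle n ω) hc.le)
  have hAm : ∀ n, AEStronglyMeasurable (A n) P := fun n =>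
    (measurable_comp_index (f := fun n ω => Real.exp (c * S n ω) * ‖D n ω‖ ^ 2)
      (fun n => (((hSm n).const_mul c).exp).mul ((hDm' n).norm.pow_const 2))
      (hτm n)).aestronglyMeasurable
  have hBm : ∀ n, AEStronglyMeasurable (B n) P := fun n =>
    (measurable_comp_index (f := fun n ω => Real.exp (c * S n ω) * u n ω)
      (fun n => (((hSm n).const_mul c).exp).mul (hum n)) (hτm n)).aestronglyMeasurable
  have hAle : ∀ n ω, ‖A n ω‖ ≤ Real.exp (c * (t + 1)) * (‖D 0 ω‖ + K / (1 - q)) ^ 2 := by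
    intro n ω
    rw [Real.norm_of_nonneg (by positivity)]
    exact mul_le_mul (hexple n ω) (by gcongr; exact hbdd _ ω) (by positivity) (Real.exp_pos _).le
  have hu0 : ∀ n ω, 0 ≤ u n ω := fun n ω => discountedSqSum_nonneg _ _ _
  have hule : ∀ n ω, u n ω ≤ Real.exp c / c := fun n ω =>
    discountedSqSum_le hc (fun k => hg0 k ω) (fun k => hg1 k ω) n
  have hBle : ∀ n ω, ‖B n ω‖ ≤ Real.exp (c * (t + 1)) * (Real.exp c / c) := by
    intro n ω
    rw [Real.norm_of_nonneg (mul_nonneg (Real.exp_pos _).le (hu0 _ _))]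
    exact mul_le_mul (hexple n ω) (hule _ ω) (hu0 _ _) (Real.exp_pos _).le
  have hAint : ∀ n, Integrable (A n) P := fun n =>
    (hbdd_int.const_mul _).mono' (hAm n) (Eventually.of_forall (hAle n))
  have hBint : ∀ n, Integrable (B n) P := fun n =>
    Integrable.of_bound (hBm n) _ (Eventually.of_forall (hBle n))
  have hstep : ∀ n, ∫ ω, A n ω ∂P ≤ ∫ ω, ‖D 0 ω‖ ^ 2 ∂P + 4 * K ^ 2 * ∫ ω, B n ω ∂P := by
    intro n
    have hcross := fun i => integral_cross_term_eq_zero hq hDm hgm hξm hind hg0 hgq hξ hξ0 hDint t i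
    have hpt : ∀ ω, A n ω ≤ ‖D 0 ω‖ ^ 2 + ∑ i ∈ Finset.range n,
        (if ∑ j ∈ Finset.range i, g j ω < t then
          Real.exp (c * ∑ j ∈ Finset.range (i + 1), g j ω) *
            (4 * g i ω * (1 - 2 * g i ω) * inner ℝ (D i ω) (ξ i ω)) else 0) +
        4 * K ^ 2 * B n ω := by
      intro ω
      have h1 := exp_mul_norm_sq_le_sum (D := fun n => D n ω) (ξ := fun n => ξ n ω)
        (g := fun n => g n ω) (fun n => hg0 n ω) (fun n => hgq n ω) (fun n => hξ n ω)
        (fun n => hD n ω) (τ n ω)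
      rw [← exp_mul_discountedSqSum] at h1
      rw [← Finset.sum_filter]
      -- `i < N ω` exactly if the accumulated step size is still below `t`
      have hfilter : (Finset.range n).filter (fun i => ∑ j ∈ Finset.range i, g j ω < t) =
          Finset.range (τ n ω) := by
        ext i
        have := hN ω i
        rw [Finset.mem_filter, Finset.mem_range, Finset.mem_range, lt_min_iff, ← not_le (a := t),
          ← this, not_le]
      rw [hfilter]
      exact h1
    have hsum : Integrable (fun ω => ∑ i ∈ Finset.range n,
        (if ∑ j ∈ Finset.range i, g j ω < t then
          Real.exp (c * ∑ j ∈ Finset.range (i + 1), g j ω) *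
            (4 * g i ω * (1 - 2 * g i ω) * inner ℝ (D i ω) (ξ i ω)) else 0)) P :=
      integrable_finsetSum _ fun i _ => (hcross i).1
    refine (integral_mono (hAint n) ((hD0.add hsum).add ((hBint n).const_mul _)) hpt).trans ?_
    have e1 := integral_add (hD0.add hsum) ((hBint n).const_mul (4 * K ^ 2))
    have e2 := integral_add hD0 hsum
    have e3 : ∫ ω, ∑ i ∈ Finset.range n, (if ∑ j ∈ Finset.range i, g j ω < t then
          Real.exp (c * ∑ j ∈ Finset.range (i + 1), g j ω) *
            (4 * g i ω * (1 - 2 * g i ω) * inner ℝ (D i ω) (ξ i ω)) else 0) ∂P = 0 := by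
      rw [integral_finsetSum _ fun i _ => (hcross i).1]
      exact Finset.sum_eq_zero fun i _ => (hcross i).2
    rw [e3] at e2
    simp only [Pi.add_apply] at e1 e2 ⊢
    rw [e1, e2, integral_const_mul]
    simp
  -- `τ n ω = N ω` for large `n`
  have hτN : ∀ ω, ∀ᶠ n in atTop, τ n ω = N ω := fun ω => by
    filter_upwards [eventually_ge_atTop (N ω)] with n hn using min_eq_right hn
  have hAlim : Tendsto (fun n => ∫ ω, A n ω ∂P) atTop
      (𝓝 (∫ ω, Real.exp (c * S (N ω) ω) * ‖D (N ω) ω‖ ^ 2 ∂P)) := by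
    refine tendsto_integral_of_dominated_convergence _ hAm (hbdd_int.const_mul _)
      (fun n => Eventually.of_forall (hAle n)) (Eventually.of_forall fun ω => ?_)
    refine tendsto_const_nhds.congr' ?_
    filter_upwards [hτN ω] with n hn
    simp only [hA_def, hn]
  have hBlim : Tendsto (fun n => ∫ ω, B n ω ∂P) atTop
      (𝓝 (∫ ω, Real.exp (c * S (N ω) ω) * u (N ω) ω ∂P)) := by
    refine tendsto_integral_of_dominated_convergence _ hBm (integrable_const _)
      (fun n => Eventually.of_forall (hBle n)) (Eventually.of_forall fun ω => ?_)
    refine tendsto_const_nhds.congr' ?_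
    filter_upwards [hτN ω] with n hn
    simp only [hB_def, hn]
  have hfinal := le_of_tendsto_of_tendsto' hAlim ((hBlim.const_mul (4 * K ^ 2)).const_add _) hstep
  have hSN : ∀ ω, S (N ω) ω ≤ t + 1 := fun ω => by
    have := hSle (N ω) ω
    simpa [hτ_def] using this
  have huN : Integrable (fun ω => u (N ω) ω) P :=
    Integrable.of_bound (measurable_comp_index hum hNm).aestronglyMeasurable (Real.exp c / c)
      (Eventually.of_forall fun ω => by rw [Real.norm_of_nonneg (hu0 _ _)]; exact hule _ ω)
  have hlow : Real.exp (c * t) * ∫ ω, ‖D (N ω) ω‖ ^ 2 ∂P ≤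
      ∫ ω, Real.exp (c * S (N ω) ω) * ‖D (N ω) ω‖ ^ 2 ∂P := by
    rw [← integral_const_mul]
    refine integral_mono_of_nonneg (Eventually.of_forall fun ω => by positivity) ?_
      (Eventually.of_forall fun ω => ?_)
    · refine (hbdd_int.const_mul (Real.exp (c * (t + 1)))).mono'
        (measurable_comp_index (f := fun n ω => Real.exp (c * S n ω) * ‖D n ω‖ ^ 2)
          (fun n => (((hSm n).const_mul c).exp).mul ((hDm' n).norm.pow_const 2))
          hNm).aestronglyMeasurable (Eventually.of_forall fun ω => ?_)
      simpa [hA_def, hτ_def] using hAle (N ω) ω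
    · have : t ≤ S (N ω) ω := (hN ω (N ω)).1 le_rfl
      simp only
      gcongr
  have hup : ∫ ω, Real.exp (c * S (N ω) ω) * u (N ω) ω ∂P ≤
      Real.exp (c * (t + 1)) * ∫ ω, u (N ω) ω ∂P := by
    rw [← integral_const_mul]
    refine integral_mono_of_nonneg (Eventually.of_forall fun ω =>
      mul_nonneg (Real.exp_pos _).le (hu0 _ _)) (huN.const_mul _) (Eventually.of_forall fun ω => ?_)
    exact mul_le_mul_of_nonneg_right
      (Real.exp_le_exp.2 (mul_le_mul_of_nonneg_left (hSN ω) hc.le)) (hu0 _ _)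
  have hK : 0 ≤ 4 * K ^ 2 := by positivity
  have h1 := (hlow.trans hfinal).trans (add_le_add_right (mul_le_mul_of_nonneg_left hup hK) _)
  have h2 := mul_le_mul_of_nonneg_left h1 (Real.exp_pos (-(c * t))).le
  rw [← mul_assoc, ← Real.exp_add, neg_add_cancel, Real.exp_zero, one_mul] at h2
  refine h2.trans (le_of_eq ?_)
  have h3 : Real.exp (c * (t + 1)) = Real.exp (c * t) * Real.exp c := by
    rw [← Real.exp_add]; ring_nf
  have h4 : Real.exp (-(c * t)) * Real.exp (c * t) = 1 := by
    rw [← Real.exp_add]; simp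
  rw [h3]
  linear_combination (4 * K ^ 2 * Real.exp c * ∫ ω, u (N ω) ω ∂P) * h4

/-- **Stochastic approximation with random step sizes.** The step sizes are predictable, bounded
away from `1`, not summable and almost surely tend to zero, and the noise is bounded, centred and
independent of the past. Then the iterate at the time at which the accumulated step size reaches
`t` tends to zero in mean as `t → ∞`. -/
theorem tendsto_integral_norm_stopped (hq : q < 1)
    (hDm : ∀ n, Measurable[ℱ n] (D n)) (hgm : ∀ n, Measurable[ℱ n] (g n))
    (hξm : ∀ n, Measurable (ξ n))
    (hind : ∀ n, Indep (ℱ n) (MeasurableSpace.comap (ξ n) inferInstance) P)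
    (hg0 : ∀ n ω, 0 < g n ω) (hgq : ∀ n ω, g n ω ≤ q) (hξ : ∀ n ω, ‖ξ n ω‖ ≤ K)
    (hξ0 : ∀ n, ∫ ω, ξ n ω ∂P = 0)
    (hD : ∀ n ω, D (n + 1) ω = (1 - 2 * g n ω) • D n ω + (2 * g n ω) • ξ n ω)
    (hD0 : Integrable (fun ω => ‖D 0 ω‖ ^ 2) P)
    (hS : ∀ ω, Tendsto (fun n => ∑ i ∈ Finset.range n, g i ω) atTop atTop)
    (hlim : ∀ᵐ ω ∂P, Tendsto (fun n => g n ω) atTop (𝓝 0))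
    (N : ℝ → Ω → ℕ)
    (hN : ∀ t, 0 ≤ t → ∀ ω n, N t ω ≤ n ↔ t ≤ ∑ i ∈ Finset.range n, g i ω) :
    (∀ t, 0 ≤ t → Integrable (fun ω => ‖D (N t ω) ω‖) P) ∧
      Tendsto (fun t : ℝ => ∫ ω, ‖D (N t ω) ω‖ ∂P) atTop (𝓝 0) := by
  set c := 4 * (1 - q) with hc_def
  have hc : 0 < c := by rw [hc_def]; linarith
  have hbdd : ∀ n ω, ‖D n ω‖ ≤ ‖D 0 ω‖ + K / (1 - q) := fun n ω =>
    norm_le_of_rec (D := fun n => D n ω) (ξ := fun n => ξ n ω) hq (fun n => hg0 n ω)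
      (fun n => hgq n ω) (fun n => hξ n ω) (fun n => hD n ω) n
  have hg1 : ∀ n ω, g n ω ≤ 1 := fun n ω => (hgq n ω).trans hq.le
  have hgm' : ∀ n, Measurable (g n) := fun n => (hgm n).mono (ℱ.le n) le_rfl
  have hDm' : ∀ n, Measurable (D n) := fun n => (hDm n).mono (ℱ.le n) le_rfl
  have hSm : ∀ n, Measurable fun ω => ∑ i ∈ Finset.range n, g i ω := fun n =>
    Finset.measurable_fun_sum _ fun j _ => hgm' j
  have hNm : ∀ t, 0 ≤ t → Measurable (N t) := fun t ht => measurable_of_Iic fun n => by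
    have : N t ⁻¹' Set.Iic n = {ω | t ≤ ∑ i ∈ Finset.range n, g i ω} := by
      ext ω; exact hN t ht ω n
    rw [this]
    exact measurableSet_le measurable_const (hSm n)
  have hL2 : MemLp (fun ω => ‖D 0 ω‖) 2 P :=
    (memLp_two_iff_integrable_sq (hDm' 0).norm.aestronglyMeasurable).2 hD0
  have hbdd2 : MemLp (fun ω => ‖D 0 ω‖ + K / (1 - q)) 2 P := hL2.add (memLp_const _)
  have hbdd_int := hbdd2.integrable_sq
  have hbdd1 := hbdd2.integrable one_le_two
  have hDint : ∀ n, Integrable (D n) P := fun n =>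
    hbdd1.mono' (hDm' n).aestronglyMeasurable (Eventually.of_forall (hbdd n))
  have hDNm : ∀ t, 0 ≤ t → Measurable fun ω => D (N t ω) ω := fun t ht =>
    measurable_comp_index hDm' (hNm t ht)
  have hDN1 : ∀ t, 0 ≤ t → Integrable (fun ω => ‖D (N t ω) ω‖) P := fun t ht =>
    hbdd1.mono' (hDNm t ht).norm.aestronglyMeasurable (Eventually.of_forall fun ω => by
      rw [norm_norm]; exact hbdd _ ω)
  have hDN2 : ∀ t, 0 ≤ t → Integrable (fun ω => ‖D (N t ω) ω‖ ^ 2) P := fun t ht =>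
    hbdd_int.mono' ((hDNm t ht).norm.pow_const 2).aestronglyMeasurable
      (Eventually.of_forall fun ω => by
        rw [Real.norm_of_nonneg (by positivity)]
        gcongr
        exact hbdd _ ω)
  refine ⟨hDN1, ?_⟩
  set u : ℕ → Ω → ℝ := fun n ω => discountedSqSum c (fun k => g k ω) n with hu_def
  have hum : ∀ n, Measurable (u n) := fun n => by
    simp only [hu_def, discountedSqSum]
    refine Measurable.div (Finset.measurable_fun_sum _ fun j _ => ?_) ((hSm n).const_mul c).exp
    exact ((hgm' j).pow_const 2).mul ((hSm (j + 1)).const_mul c).exp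
  have hu_lim : Tendsto (fun t : ℝ => ∫ ω, u (N t ω) ω ∂P) atTop (𝓝 0) := by
    have h : Tendsto (fun t : ℝ => ∫ ω, u (N t ω) ω ∂P) atTop (𝓝 (∫ _ : Ω, (0 : ℝ) ∂P)) := by
      refine tendsto_integral_filter_of_dominated_convergence (fun _ => Real.exp c / c) ?_ ?_
        (integrable_const _) ?_
      · filter_upwards [eventually_ge_atTop (0 : ℝ)] with t ht
        exact (measurable_comp_index hum (hNm t ht)).aestronglyMeasurable
      · refine Eventually.of_forall fun t => Eventually.of_forall fun ω => ?_
        rw [Real.norm_of_nonneg (discountedSqSum_nonneg _ _ _)]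
        exact discountedSqSum_le hc (fun k => hg0 k ω) (fun k => hg1 k ω) _
      · filter_upwards [hlim] with ω hω
        have hNlim : Tendsto (fun t : ℝ => N t ω) atTop atTop := by
          refine tendsto_atTop.2 fun n => ?_
          filter_upwards [eventually_ge_atTop (0 : ℝ),
            eventually_gt_atTop (∑ i ∈ Finset.range n, g i ω)] with t ht htn
          by_contra h
          exact absurd ((hN t ht ω n).1 (by omega)) (by linarith)
        exact (tendsto_discountedSqSum hc (fun k => hg0 k ω) (fun k => hg1 k ω) hω (hS ω)).comp
          hNlim
    simpa using h
  have hexp : Tendsto (fun t : ℝ => Real.exp (-(c * t))) atTop (𝓝 0) :=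
    Real.tendsto_exp_neg_atTop_nhds_zero.comp (tendsto_id.const_mul_atTop hc)
  have hbound := ((hexp.mul_const (∫ ω, ‖D 0 ω‖ ^ 2 ∂P)).add
    (hu_lim.const_mul (4 * K ^ 2 * Real.exp c))).sqrt
  rw [zero_mul, mul_zero, add_zero, Real.sqrt_zero] at hbound
  refine tendsto_of_tendsto_of_tendsto_of_le_of_le' tendsto_const_nhds hbound
    (Eventually.of_forall fun t => integral_nonneg fun ω => norm_nonneg _) ?_
  filter_upwards [eventually_ge_atTop (0 : ℝ)] with t ht
  refine (integral_le_sqrt_integral_sq (hDN1 t ht) (hDN2 t ht)).trans (Real.sqrt_le_sqrt ?_)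
  exact integral_norm_sq_stopped_le hq hDm hgm hξm hind hg0 hgq hξ hξ0 hD hD0 hbdd t ht (N t)
    (hN t ht) hbdd_int hDint (hNm t ht)

end Stopped

/-! ### The adaptive step sizes -/

section StepSizes

variable {ν : ℕ → ℝ}

theorem eq_succ_of_isGreatest (hν_pos : ∀ n, 1 ≤ n → 0 < ν n) (hν_anti : StrictAntiOn ν (Set.Ici 1))
    {k : ℕ} (hk : 1 ≤ k) {x : ℝ} (hx : IsGreatest (Set.Ioo 0 (ν k) ∩ ν '' Set.Ici 1) x) :
    x = ν (k + 1) := by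
  have hk' : k + 1 ∈ Set.Ici 1 := by simp
  refine hx.unique ⟨⟨⟨hν_pos _ (by omega), hν_anti hk hk' (by omega)⟩, _, hk', rfl⟩, ?_⟩
  rintro _ ⟨⟨_, h2⟩, j, hj, rfl⟩
  exact hν_anti.antitoneOn hk' hj ((hν_anti.lt_iff_gt hj hk).1 h2)

variable {R : ℕ → Prop} [DecidablePred R]

/-- The step size is `ν (k + 1)`, where `k` is the number of reductions made so far. -/
theorem stepSize_eq_count (hν_pos : ∀ n, 1 ≤ n → 0 < ν n) (hν_anti : StrictAntiOn ν (Set.Ici 1))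
    {γ : ℕ → ℝ} (h1 : γ 1 = ν 1) (hkeep : ∀ n, ¬ R n → γ (n + 2) = γ (n + 1))
    (hred : ∀ n, R n → IsGreatest (Set.Ioo 0 (γ (n + 1)) ∩ ν '' Set.Ici 1) (γ (n + 2))) (n : ℕ) :
    γ (n + 1) = ν (Nat.count R n + 1) := by
  induction n with
  | zero => simpa using h1
  | succ n ih =>
    rw [Nat.count_succ]
    split_ifs with h
    · have := hred n h
      rw [ih] at this
      exact eq_succ_of_isGreatest hν_pos hν_anti (by omega) this
    · rw [hkeep n h, ih, add_zero]

theorem tendsto_count_of_frequently (h : ∃ᶠ n in atTop, R n) :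
    Tendsto (Nat.count R) atTop atTop := by
  have hinf : {n | R n}.Infinite := Nat.frequently_atTop_iff_infinite.1 h
  exact tendsto_atTop_atTop_of_monotone (Nat.count_monotone R) fun b =>
    ⟨Nat.nth R b, (Nat.count_nth_of_infinite hinf b).ge⟩

/-- The step sizes are never summable: either every `ν k` is used, or the step size is bounded
below. -/
theorem tendsto_sum_stepSize (hν_pos : ∀ n, 1 ≤ n → 0 < ν n)
    (hν_anti : StrictAntiOn ν (Set.Ici 1))
    (hν_sum : Tendsto (fun n : ℕ => ∑ k ∈ Finset.Icc 1 n, ν k) atTop atTop) :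
    Tendsto (fun n => ∑ i ∈ Finset.range n, ν (Nat.count R i + 1)) atTop atTop := by
  by_cases h : ∃ᶠ n in atTop, R n
  · refine tendsto_atTop_mono (fun n => ?_) (hν_sum.comp (tendsto_count_of_frequently h))
    simp only [Function.comp_apply]
    induction n with
    | zero => simp
    | succ n ih =>
      rw [Finset.sum_range_succ, Nat.count_succ]
      split_ifs with hR
      · rw [Finset.sum_Icc_succ_top (by omega)]
        linarith
      · rw [add_zero]
        linarith [hν_pos (Nat.count R n + 1) (by omega)]
  · obtain ⟨n₀, hn₀⟩ := eventually_atTop.1 (not_frequently.1 h)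
    have hconst : ∀ n, Nat.count R n ≤ Nat.count R n₀ := by
      intro n
      rcases le_total n n₀ with hn | hn
      · exact Nat.count_monotone R hn
      · induction n, hn using Nat.le_induction with
        | base => exact le_rfl
        | succ n hn ih => rw [Nat.count_succ, if_neg (hn₀ n hn), add_zero]; exact ih
    have hpos := hν_pos (Nat.count R n₀ + 1) (by omega)
    refine tendsto_atTop_mono (fun n => ?_)
      (tendsto_natCast_atTop_atTop.atTop_mul_const hpos)
    rw [← nsmul_eq_mul, ← Finset.card_range n, ← Finset.sum_const, Finset.card_range]
    exact Finset.sum_le_sum fun i _ => hν_anti.antitoneOn (by simp) (by simp)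
      (Nat.add_le_add_right (hconst i) 1)

end StepSizes

/-! ### A pattern of data that forces the test loss to increase -/

section Escape

variable {E : Type*} [NormedAddCommGroup E] [InnerProductSpace ℝ E]

/-- If the iterate and the test point `w` are near `x`, then a step towards data near a point `y` far
from `x` increases the distance to `w`. -/
theorem norm_sub_lt_norm_step_sub {x y θ z w : E} {G C ε : ℝ} (hG0 : 0 < G) (hG1 : G < 1)
    (hε : ε * (2 * G + 2 * C + 2) < 2 * G * ‖y - x‖)
    (hθ : ‖θ - x‖ ≤ C * ε) (hz : ‖z - y‖ ≤ ε) (hw : ‖w - x‖ ≤ ε) :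
    ‖θ - w‖ < ‖(1 - 2 * G) • θ + (2 * G) • z - w‖ := by
  have h1 : ‖θ - w‖ ≤ ‖θ - x‖ + ‖w - x‖ := by
    rw [show θ - w = (θ - x) - (w - x) by abel]
    exact norm_sub_le _ _
  have h2 : (2 * G) • (y - x) = ((1 - 2 * G) • θ + (2 * G) • z - w) -
      ((1 - 2 * G) • (θ - x) + (2 * G) • (z - y)) + (w - x) := by module
  have h3 : 2 * G * ‖y - x‖ ≤ ‖(1 - 2 * G) • θ + (2 * G) • z - w‖ +
      ‖(1 - 2 * G) • (θ - x) + (2 * G) • (z - y)‖ + ‖w - x‖ := by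
    calc 2 * G * ‖y - x‖ = ‖(2 * G) • (y - x)‖ := by
          rw [norm_smul, Real.norm_of_nonneg (by linarith)]
      _ ≤ _ := by
          rw [h2]
          exact (norm_add_le _ _).trans (add_le_add_left (norm_sub_le _ _) _)
  have h4 := norm_step_le (θ - x) (z - y) hG0.le
  have h5 : |1 - 2 * G| * ‖θ - x‖ ≤ ‖θ - x‖ :=
    mul_le_of_le_one_left (norm_nonneg _) (abs_one_sub_two_mul_lt_one hG0 hG1).le
  have h6 : 2 * G * ‖z - y‖ ≤ 2 * G * ε := by gcongr
  linarith

/-- Let `θ` be driven with constant step size `G` from time `n₀` on by bounded data `z`. Then there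
are a precision `ε` and a block length `r + 1` such that, whenever in some later block all data but
the last is `ε`-close to `x` and the last one is `ε`-close to `y ≠ x`, the last step of the block
increases the distance to all points `ε`-close to `x`. -/
theorem exists_block_forcing_increase {θ z : ℕ → E} {x y : E} {G K : ℝ} {n₀ : ℕ} (hG0 : 0 < G)
    (hG1 : G < 1) (hxy : x ≠ y) (hK : ∀ n, ‖z n - x‖ ≤ K)
    (hθ : ∀ n ≥ n₀, θ (n + 1) = (1 - 2 * G) • θ n + (2 * G) • z n) :
    ∃ m r : ℕ, ∀ b ≥ n₀, (∀ k < r, ‖z (b + k) - x‖ ≤ 1 / ((m : ℝ) + 2)) →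
      ‖z (b + r) - y‖ ≤ 1 / ((m : ℝ) + 2) →
      ∀ w, ‖w - x‖ ≤ 1 / ((m : ℝ) + 2) → ‖θ (b + r) - w‖ < ‖θ (b + r + 1) - w‖ := by
  set q := |1 - 2 * G| with hq
  have hq0 : 0 ≤ q := abs_nonneg _
  have hq1 : q < 1 := abs_one_sub_two_mul_lt_one hG0 hG1
  have hK0 : 0 ≤ K := (norm_nonneg _).trans (hK 0)
  have hstep : ∀ n ≥ n₀, ‖θ (n + 1) - x‖ ≤ q * ‖θ n - x‖ + 2 * G * ‖z n - x‖ := fun n hn => by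
    rw [hθ n hn, show (1 - 2 * G) • θ n + (2 * G) • z n - x =
      (1 - 2 * G) • (θ n - x) + (2 * G) • (z n - x) by module]
    exact norm_step_le _ _ hG0.le
  set B := ‖θ n₀ - x‖ + 2 * G * K / (1 - q)
  have hB : ∀ n ≥ n₀, ‖θ n - x‖ ≤ B := by
    intro n hn
    obtain ⟨k, rfl⟩ := Nat.exists_eq_add_of_le hn
    have h := le_pow_mul_add_of_affine_rec (v := fun k => ‖θ (n₀ + k) - x‖) (c := 2 * G * K)
      (r := k) hq0 hq1 (by positivity) (fun k _ => (hstep (n₀ + k) (by omega)).trans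
        (by gcongr; exact hK _)) k le_rfl
    refine h.trans (add_le_add_left ?_ _)
    exact mul_le_of_le_one_left (norm_nonneg _) (pow_le_one₀ hq0 hq1.le)
  set C := 1 + 2 * G / (1 - q) with hC_def
  have hd : 0 < ‖y - x‖ := norm_pos_iff.2 (sub_ne_zero.2 hxy.symm)
  obtain ⟨m, hm⟩ := exists_nat_gt ((2 * G + 2 * C + 2) / (2 * G * ‖y - x‖))
  rw [div_lt_iff₀ (by positivity)] at hm
  set ε : ℝ := 1 / ((m : ℝ) + 2) with hε_def
  have hε0 : 0 < ε := by positivity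
  have hε : ε * (2 * G + 2 * C + 2) < 2 * G * ‖y - x‖ := by
    rw [hε_def, one_div_mul_eq_div, div_lt_iff₀ (by positivity)]
    have : 0 < 2 * G * ‖y - x‖ := by positivity
    nlinarith
  -- `r` steps towards `x` bring the iterate from distance `B` to distance `C * ε`
  obtain ⟨r, hr⟩ : ∃ r : ℕ, q ^ r * B ≤ ε := by
    have h : Tendsto (fun r : ℕ => q ^ r * B) atTop (𝓝 (0 * B)) :=
      (tendsto_pow_atTop_nhds_zero_of_lt_one hq0 hq1).mul_const B
    rw [zero_mul] at h
    exact (h.eventually_le_const hε0).exists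
  refine ⟨m, r, fun b hb hx hy w hw => ?_⟩
  rw [hθ (b + r) (by omega)]
  refine norm_sub_lt_norm_step_sub hG0 hG1 hε ?_ hy hw
  have h := le_pow_mul_add_of_affine_rec (v := fun k => ‖θ (b + k) - x‖) (c := 2 * G * ε)
    (r := r) hq0 hq1 (by positivity) (fun k hk => (hstep (b + k) (by omega)).trans
      (by gcongr; exact hx k hk)) r le_rfl
  refine h.trans ?_
  have h1 : q ^ r * ‖θ (b + 0) - x‖ ≤ q ^ r * B := by gcongr; exact hB b hb
  have h2 : 2 * G * ε / (1 - q) = 2 * G / (1 - q) * ε := by ring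
  rw [h2, hC_def]
  linarith

theorem norm_smul_sum_sub_le {M : ℕ} (hM : 1 ≤ M) {X : ℕ → E} {x : E} {ε : ℝ}
    (h : ∀ m ∈ Finset.Icc 1 M, ‖X m - x‖ ≤ ε) :
    ‖(M : ℝ)⁻¹ • ∑ m ∈ Finset.Icc 1 M, X m - x‖ ≤ ε := by
  have hM0 : (0 : ℝ) < M := by exact_mod_cast hM
  have h1 : (M : ℝ)⁻¹ • ∑ m ∈ Finset.Icc 1 M, X m - x =
      (M : ℝ)⁻¹ • ∑ m ∈ Finset.Icc 1 M, (X m - x) := by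
    rw [Finset.sum_sub_distrib, smul_sub, Finset.sum_const, Nat.card_Icc, Nat.add_sub_cancel,
      ← Nat.cast_smul_eq_nsmul ℝ, smul_smul, inv_mul_cancel₀ hM0.ne', one_smul]
  rw [h1, norm_smul, Real.norm_of_nonneg (by positivity), inv_mul_le_iff₀ hM0]
  refine (norm_sum_le_of_le _ h).trans (le_of_eq ?_)
  simp

end Escape

/-! ### Every pattern occurs infinitely often -/

/-- In an independent family, consider disjoint blocks of bounded size. If the variables hit
prescribed sets with probabilities bounded away from zero, then almost surely there are infinitely
many blocks in which all variables do so, by the second Borel–Cantelli lemma. -/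
theorem ae_frequently_forall_mem_block {Ω ι β : Type*} {mΩ : MeasurableSpace Ω} {P : Measure Ω}
    [IsProbabilityMeasure P] [DecidableEq ι] [MeasurableSpace β] {X : ι → Ω → β}
    (hX : iIndepFun X P) (hXm : ∀ i, Measurable (X i)) {T : ℕ → Finset ι}
    (hT : Pairwise (Function.onFun Disjoint T)) {B : ι → Set β} (hB : ∀ i, MeasurableSet (B i))
    {p : ENNReal} (hp : p ≠ 0) (hp1 : p ≤ 1) (hpB : ∀ i, p ≤ P (X i ⁻¹' B i)) {C : ℕ}
    (hC : ∀ j, (T j).card ≤ C) : ∀ᵐ ω ∂P, ∃ᶠ j in atTop, ∀ i ∈ T j, X i ω ∈ B i := by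
  set s : ℕ → Set Ω := fun j => ⋂ i ∈ T j, X i ⁻¹' B i with hs_def
  have hsm : ∀ j, MeasurableSet (s j) := fun j =>
    Finset.measurableSet_biInter _ fun i _ => hXm i (hB i)
  have hPs : ∀ j, P (s j) = ∏ i ∈ T j, P (X i ⁻¹' B i) := fun j =>
    hX.measure_inter_preimage_eq_mul (T j) fun i _ => hB i
  have hind : iIndepSet s P := by
    refine (iIndepSet_iff_meas_biInter hsm).2 fun S => ?_
    have h1 : ⋂ j ∈ S, s j = ⋂ i ∈ S.biUnion T, X i ⁻¹' B i := by
      ext ω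
      simp only [hs_def, Set.mem_iInter, Finset.mem_biUnion]
      exact ⟨fun h i ⟨j, hj, hi⟩ => h j hj i hi, fun h j hj i hi => h i ⟨j, hj, hi⟩⟩
    rw [h1, hX.measure_inter_preimage_eq_mul _ fun i _ => hB i,
      Finset.prod_biUnion fun i _ j _ hij => hT hij]
    exact Finset.prod_congr rfl fun j _ => (hPs j).symm
  have hlow : ∀ j, p ^ C ≤ P (s j) := by
    intro j
    calc p ^ C ≤ p ^ (T j).card := pow_le_pow_right_of_le_one' hp1 (hC j)
      _ = ∏ _i ∈ T j, p := by rw [Finset.prod_const]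
      _ ≤ P (s j) := by rw [hPs]; exact Finset.prod_le_prod' fun i _ => hpB i
  have hsum : ∑' j, P (s j) = ⊤ := by
    refine top_le_iff.1 (le_trans ?_ (ENNReal.tsum_le_tsum hlow))
    rw [ENNReal.tsum_const_eq_top_of_ne_zero (pow_ne_zero _ hp)]
  have h := (prob_compl_eq_zero_iff (MeasurableSet.measurableSet_limsup hsm)).2
    (measure_limsup_eq_one hsm hind hsum)
  filter_upwards [compl_mem_ae_iff.2 h] with ω hω
  rw [compl_compl, mem_limsup_iff_frequently_mem] at hω
  exact hω.mono fun j hj i hi => by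
    simp only [hs_def, Set.mem_iInter] at hj
    exact hj i hi

/-! ### The filtration of the past -/

section Past

variable {Ω α β δ ι : Type*} {mΩ : MeasurableSpace Ω} {P : Measure Ω}
  [MeasurableSpace α] [MeasurableSpace β] [MeasurableSpace δ]

theorem indepFun_prodMk_of_indepFun [IsProbabilityMeasure P] {U : Ω → α} {V : Ω → β} {W : Ω → δ}
    (hU : Measurable U) (hV : Measurable V) (hW : Measurable W)
    (h1 : IndepFun U (fun ω => (V ω, W ω)) P) (h2 : IndepFun V W P) :
    IndepFun (fun ω => (U ω, V ω)) W P := by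
  have hUV : IndepFun U V P := h1.comp measurable_id measurable_fst
  have : IsProbabilityMeasure (P.map U) := Measure.isProbabilityMeasure_map hU.aemeasurable
  have : IsProbabilityMeasure (P.map V) := Measure.isProbabilityMeasure_map hV.aemeasurable
  have : IsProbabilityMeasure (P.map W) := Measure.isProbabilityMeasure_map hW.aemeasurable
  rw [indepFun_iff_map_prod_eq_prod_map_map hU.aemeasurable (hV.prodMk hW).aemeasurable,
    (indepFun_iff_map_prod_eq_prod_map_map hV.aemeasurable hW.aemeasurable).1 h2] at h1
  rw [indepFun_iff_map_prod_eq_prod_map_map (hU.prodMk hV).aemeasurable hW.aemeasurable,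
    (indepFun_iff_map_prod_eq_prod_map_map hU.aemeasurable hV.aemeasurable).1 hUV]
  apply MeasurableEquiv.prodAssoc.map_measurableEquiv_injective
  rw [Measure.prodAssoc_prod, ← h1, Measure.map_map MeasurableEquiv.prodAssoc.measurable
    ((hU.prodMk hV).prodMk hW)]
  rfl

/-- The filtration generated by an initial value `Y` and, at time `n`, by the variables `X i` with
`i ∈ T n`. -/
def pastFiltration (Y : Ω → α) (X : ι → Ω → β) (T : ℕ → Finset ι) (hT : Monotone T)
    (hY : Measurable Y) (hX : ∀ i, Measurable (X i)) : Filtration ℕ mΩ where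
  seq n := MeasurableSpace.comap (fun ω => (Y ω, fun i : T n => X i ω)) inferInstance
  mono' m n hmn := by
    have h : Measurable fun p : α × (T n → β) => (p.1, fun i : T m => p.2 ⟨i, hT hmn i.2⟩) :=
      measurable_fst.prodMk
        (measurable_pi_lambda _ fun i => (measurable_pi_apply _).comp measurable_snd)
    exact (h.comp (comap_measurable fun ω => (Y ω, fun i : T n => X i ω))).comap_le
  le' n := (hY.prodMk (measurable_pi_lambda _ fun i : T n => hX i)).comap_le

theorem measurable_comap_restrict {X : ι → Ω → β} {T : Finset ι} {i : ι} (hi : i ∈ T) :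
    Measurable[MeasurableSpace.comap (fun ω (i : T) => X i ω) inferInstance] (X i) :=
  (measurable_pi_apply (⟨i, hi⟩ : T)).comp (comap_measurable fun ω (i : T) => X i ω)

variable {Y : Ω → α} {X : ι → Ω → β} {T : ℕ → Finset ι} (hT : Monotone T) (hY : Measurable Y)
  (hX : ∀ i, Measurable (X i))

theorem measurable_initial_pastFiltration (n : ℕ) :
    Measurable[pastFiltration Y X T hT hY hX n] Y :=
  measurable_fst.comp (comap_measurable fun ω => (Y ω, fun i : T n => X i ω))

theorem measurable_pastFiltration {n : ℕ} {i : ι} (hi : i ∈ T n) :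
    Measurable[pastFiltration Y X T hT hY hX n] (X i) :=
  ((measurable_pi_apply (⟨i, hi⟩ : T n)).comp measurable_snd).comp
    (comap_measurable fun ω => (Y ω, fun i : T n => X i ω))

/-- Variables that depend only on indices outside `T n` are independent of the past at time `n`. -/
theorem indep_pastFiltration [IsProbabilityMeasure P] (hXi : iIndepFun X P)
    (hXY : IndepFun (fun ω i => X i ω) Y P) {n : ℕ} {T' : Finset ι} (hT' : Disjoint (T n) T')
    {V : Ω → δ}
    (hV : Measurable[MeasurableSpace.comap (fun ω (i : T') => X i ω) inferInstance] V) :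
    Indep (pastFiltration Y X T hT hY hX n) (MeasurableSpace.comap V inferInstance) P := by
  refine indep_of_indep_of_le_right ?_ hV.comap_le
  refine indepFun_prodMk_of_indepFun hY (measurable_pi_lambda _ fun i => hX i)
    (measurable_pi_lambda _ fun i => hX i) ?_ (hXi.indepFun_finset (T n) T' hT' hX)
  have hφ : Measurable fun f : ι → β => ((fun i : T n => f i), (fun i : T' => f i)) :=
    (measurable_pi_lambda _ fun i => measurable_pi_apply _).prodMk
      (measurable_pi_lambda _ fun i => measurable_pi_apply _)
  exact hXY.symm.comp measurable_id hφ

end Past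

/-! ### The data -/

section Data

variable {d : ℕ}

theorem gradient_norm_sub_sq (x θ : EuclideanSpace ℝ (Fin d)) :
    gradient (fun θ => ‖θ - x‖ ^ 2) θ = (2 : ℝ) • (θ - x) := by
  have h := ((hasFDerivAt_id θ).sub_const x).norm_sq
  refine HasGradientAt.gradient (hasGradientAt_iff_hasFDerivAt.2 (h.congr_fderiv ?_))
  ext v
  simp

theorem norm_sub_le_of_mem_box {a b : ℝ} {u v : EuclideanSpace ℝ (Fin d)}
    (hu : ∀ i, u i ∈ Set.Icc a b) (hv : ∀ i, v i ∈ Set.Icc a b) :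
    ‖u - v‖ ≤ √(d * (b - a) ^ 2) := by
  rw [EuclideanSpace.norm_eq]
  refine Real.sqrt_le_sqrt ?_
  calc ∑ i, ‖(u - v) i‖ ^ 2 ≤ ∑ _i : Fin d, (b - a) ^ 2 := by
        refine Finset.sum_le_sum fun i _ => ?_
        rw [Real.norm_eq_abs, sq_abs, PiLp.sub_apply]
        exact sq_le_sq' (by linarith [(hu i).1, (hv i).2]) (by linarith [(hu i).2, (hv i).1])
    _ = _ := by simp

/-- Almost surely, for all precisions `1 / (m + 2)` and all block lengths `r + 1`, there are
infinitely many blocks of rows of the following form: the training data are close to `x`, but close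
to `y` in the last row, and the test data of the last row are close to `x`. -/
theorem ae_frequently_pattern {Ω : Type*} {mΩ : MeasurableSpace Ω} {P : Measure Ω}
    [IsProbabilityMeasure P] {X : ℤ → ℤ → Ω → EuclideanSpace ℝ (Fin d)}
    (hX_meas : ∀ n m, Measurable (X n m))
    (hX_indep : iIndepFun (fun (p : ℤ × ℤ) (ω : Ω) => X p.1 p.2 ω) P)
    (hX_ident : ∀ n m, IdentDistrib (X n m) (X 0 0) P P) {x y : EuclideanSpace ℝ (Fin d)}
    (hx : ∀ ε ∈ Set.Ioo (0 : ℝ) 1, 0 < P {ω | ‖X 0 0 ω - x‖ < ε})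
    (hy : ∀ ε ∈ Set.Ioo (0 : ℝ) 1, 0 < P {ω | ‖X 0 0 ω - y‖ < ε}) (M M' : ℕ) :
    ∀ᵐ ω ∂P, ∀ m r : ℕ, ∃ᶠ j : ℕ in atTop,
      (∀ k < r, ∀ i ∈ Finset.Icc 1 M,
        ‖X ((j * (r + 1) + k + 1 : ℕ) : ℤ) (i : ℤ) ω - x‖ ≤ 1 / ((m : ℝ) + 2)) ∧
      (∀ i ∈ Finset.Icc 1 M,
        ‖X ((j * (r + 1) + r + 1 : ℕ) : ℤ) (i : ℤ) ω - y‖ ≤ 1 / ((m : ℝ) + 2)) ∧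
      ∀ i ∈ Finset.Icc 1 M',
        ‖X ((j * (r + 1) + r + 1 : ℕ) : ℤ) (-(i : ℤ)) ω - x‖ ≤ 1 / ((m : ℝ) + 2) := by
  rw [ae_all_iff]
  intro m
  rw [ae_all_iff]
  intro r
  set ε : ℝ := 1 / ((m : ℝ) + 2) with hε_def
  have hε : ε ∈ Set.Ioo (0 : ℝ) 1 := by
    refine ⟨by positivity, ?_⟩
    rw [hε_def, div_lt_one (by positivity)]
    have : (0 : ℝ) ≤ m := Nat.cast_nonneg m
    linarith
  -- the last row of each block is the one divisible by the block length
  set c : ℤ × ℤ → EuclideanSpace ℝ (Fin d) :=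
    fun p => if 1 ≤ p.2 ∧ ((r + 1 : ℕ) : ℤ) ∣ p.1 then y else x with hc_def
  set T : ℕ → Finset (ℤ × ℤ) := fun j =>
    Finset.Ioc ((j * (r + 1) : ℕ) : ℤ) (((j + 1) * (r + 1) : ℕ) : ℤ) ×ˢ Finset.Icc (-(M' : ℤ)) M
    with hT_def
  have hdisj : ∀ i j : ℕ, i < j → Disjoint (T i) (T j) := by
    intro i j hij
    rw [Finset.disjoint_left]
    rintro ⟨n, k⟩ h1 h2
    simp only [hT_def, Finset.mem_product, Finset.mem_Ioc] at h1 h2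
    have h3 : (i + 1) * (r + 1) ≤ j * (r + 1) := Nat.mul_le_mul_right _ hij
    have h4 : (((i + 1) * (r + 1) : ℕ) : ℤ) ≤ ((j * (r + 1) : ℕ) : ℤ) := by exact_mod_cast h3
    linarith [h1.1.2, h2.1.1]
  have hT : Pairwise (Function.onFun Disjoint T) := fun i j hij => by
    rcases lt_or_gt_of_ne hij with h | h
    · exact hdisj i j h
    · exact (hdisj j i h).symm
  have hcard : ∀ j, (T j).card ≤ (r + 1) * (M + 1 + M') := by
    intro j
    simp only [hT_def, Finset.card_product, Int.card_Ioc, Int.card_Icc]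
    refine Nat.mul_le_mul (le_of_eq ?_) (by omega)
    rw [add_mul, one_mul, Nat.cast_add, add_sub_cancel_left, Int.toNat_natCast]
  have hball : ∀ (q : ℤ × ℤ) (v : EuclideanSpace ℝ (Fin d)),
      P ((fun ω => X q.1 q.2 ω) ⁻¹' Metric.ball v ε) = P {ω | ‖X 0 0 ω - v‖ < ε} := by
    intro q v
    rw [(hX_ident q.1 q.2).measure_mem_eq Metric.isOpen_ball.measurableSet]
    congr 1
  have key := ae_frequently_forall_mem_block hX_indep (fun p => hX_meas p.1 p.2) hT
    (B := fun p => Metric.ball (c p) ε) (fun p => Metric.isOpen_ball.measurableSet)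
    (p := min (P {ω | ‖X 0 0 ω - x‖ < ε}) (P {ω | ‖X 0 0 ω - y‖ < ε}))
    (lt_min (hx ε hε) (hy ε hε)).ne' ((min_le_left _ _).trans prob_le_one)
    (fun p => by
      rw [hball, hc_def]
      dsimp only
      split_ifs
      · exact min_le_right _ _
      · exact min_le_left _ _) hcard
  filter_upwards [key] with ω hω
  refine hω.mono fun j hj => ?_
  have hrow : ∀ k ≤ r, ∀ i : ℤ, -(M' : ℤ) ≤ i → i ≤ M →
      ‖X ((j * (r + 1) + k + 1 : ℕ) : ℤ) i ω - c (((j * (r + 1) + k + 1 : ℕ) : ℤ), i)‖ ≤ ε := by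
    intro k hk i hi1 hi2
    have h := hj (((j * (r + 1) + k + 1 : ℕ) : ℤ), i) (by
      simp only [hT_def, Finset.mem_product, Finset.mem_Ioc, Finset.mem_Icc]
      refine ⟨⟨by exact_mod_cast (by omega), ?_⟩, hi1, hi2⟩
      have : j * (r + 1) + k + 1 ≤ (j + 1) * (r + 1) := by rw [add_mul]; omega
      exact_mod_cast this)
    rw [mem_ball_iff_norm] at h
    exact h.le
  have hdvd : ((r + 1 : ℕ) : ℤ) ∣ ((j * (r + 1) + r + 1 : ℕ) : ℤ) :=
    Int.natCast_dvd_natCast.2 ⟨j + 1, by ring⟩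
  refine ⟨fun k hk i hi => ?_, fun i hi => ?_, fun i hi => ?_⟩
  · rw [Finset.mem_Icc] at hi
    have h := hrow k hk.le i (by omega) (by omega)
    have hnd : ¬ ((r + 1 : ℕ) : ℤ) ∣ ((j * (r + 1) + k + 1 : ℕ) : ℤ) := by
      rw [Int.natCast_dvd_natCast, add_assoc, Nat.dvd_add_right (Dvd.intro_left j rfl)]
      exact Nat.not_dvd_of_pos_of_lt (by omega) (by omega)
    have hc : c (((j * (r + 1) + k + 1 : ℕ) : ℤ), (i : ℤ)) = x := if_neg fun h => hnd h.2
    rwa [hc] at h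
  · rw [Finset.mem_Icc] at hi
    have h := hrow r le_rfl i (by omega) (by omega)
    have hc : c (((j * (r + 1) + r + 1 : ℕ) : ℤ), (i : ℤ)) = y :=
      if_pos ⟨Nat.one_le_cast.2 hi.1, hdvd⟩
    rwa [hc] at h
  · rw [Finset.mem_Icc] at hi
    have h := hrow r le_rfl (-(i : ℤ)) (by omega) (by omega)
    have hc : c (((j * (r + 1) + r + 1 : ℕ) : ℤ), -(i : ℤ)) = x :=
      if_neg fun h => by
        have := h.1
        simp only at this
        omega
    rwa [hc] at h

end Data

/-! ### Batch means and adaptedness -/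

section Batches

variable {Ω E : Type*} [NormedAddCommGroup E]

theorem integral_batchMean_sub_eq_zero [NormedSpace ℝ E] [CompleteSpace E]
    {mΩ : MeasurableSpace Ω} {P : Measure Ω} [IsProbabilityMeasure P] {M : ℕ} (hM : 1 ≤ M)
    {X : ℕ → Ω → E} {μ : E} (hX : ∀ i, Integrable (X i) P) (hμ : ∀ i, ∫ ω, X i ω ∂P = μ) :
    ∫ ω, ((M : ℝ)⁻¹ • ∑ i ∈ Finset.Icc 1 M, X i ω - μ) ∂P = 0 := by
  have hM0 : (M : ℝ) ≠ 0 := by exact_mod_cast (by omega : M ≠ 0)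
  have hsum : Integrable (fun ω => ∑ i ∈ Finset.Icc 1 M, X i ω) P :=
    integrable_finsetSum _ fun i _ => hX i
  have hmean : Integrable (fun ω => (M : ℝ)⁻¹ • ∑ i ∈ Finset.Icc 1 M, X i ω) P := hsum.smul _
  rw [integral_sub hmean (integrable_const _), integral_smul,
    integral_finsetSum _ fun i _ => hX i]
  simp only [hμ, Finset.sum_const, Nat.card_Icc, Nat.add_sub_cancel, integral_const,
    probReal_univ, one_smul]
  rw [← Nat.cast_smul_eq_nsmul ℝ, smul_smul, inv_mul_cancel₀ hM0, one_smul, sub_self]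

variable [SecondCountableTopology E] [MeasurableSpace E] [BorelSpace E]

theorem measurable_batchMean [NormedSpace ℝ E] {m : MeasurableSpace Ω} {M : ℕ} {X : ℕ → Ω → E}
    (hX : ∀ i ∈ Finset.Icc 1 M, Measurable[m] (X i)) :
    Measurable[m] fun ω => (M : ℝ)⁻¹ • ∑ i ∈ Finset.Icc 1 M, X i ω :=
  (Finset.measurable_fun_sum _ hX).const_smul _

theorem measurable_sum_norm_sub_sq {m : MeasurableSpace Ω} {M : ℕ} {X : ℕ → Ω → E} {θ : Ω → E}
    (hθ : Measurable[m] θ) (hX : ∀ i ∈ Finset.Icc 1 M, Measurable[m] (X i)) :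
    Measurable[m] fun ω => ∑ i ∈ Finset.Icc 1 M, ‖θ ω - X i ω‖ ^ 2 :=
  Finset.measurable_fun_sum _ fun i hi => (hθ.sub (hX i hi)).norm.pow_const 2

/-- The iterates and the number of reductions before time `n` depend only on the past at time `n`. -/
theorem measurable_iterate_and_count [NormedSpace ℝ E] {mΩ : MeasurableSpace Ω}
    {ℱ : Filtration ℕ mΩ} {Θ z : ℕ → Ω → E} {ν : ℕ → ℝ}
    {R : Ω → ℕ → Prop} [∀ ω, DecidablePred (R ω)] (hΘ0 : Measurable[ℱ 0] (Θ 0))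
    (hz : ∀ n, Measurable[ℱ (n + 1)] (z n))
    (hΘ : ∀ n ω, Θ (n + 1) ω = (1 - 2 * ν (Nat.count (R ω) n + 1)) • Θ n ω +
      (2 * ν (Nat.count (R ω) n + 1)) • z n ω)
    (hR : ∀ n, Measurable[ℱ (n + 1)] (Θ n) → Measurable[ℱ (n + 1)] (Θ (n + 1)) →
      MeasurableSet[ℱ (n + 1)] {ω | R ω n}) (n : ℕ) :
    Measurable[ℱ n] (Θ n) ∧ Measurable[ℱ n] fun ω => Nat.count (R ω) n := by
  induction n with
  | zero => exact ⟨hΘ0, by simp only [Nat.count_zero]; exact measurable_const⟩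
  | succ n ih =>
    have hle : ℱ n ≤ ℱ (n + 1) := ℱ.mono (Nat.le_succ n)
    have hΘn : Measurable[ℱ (n + 1)] (Θ n) := ih.1.mono hle le_rfl
    have hcn : Measurable[ℱ (n + 1)] fun ω => Nat.count (R ω) n := ih.2.mono hle le_rfl
    have hgn : Measurable[ℱ (n + 1)] fun ω => ν (Nat.count (R ω) n + 1) :=
      (measurable_from_nat (f := fun k => ν (k + 1))).comp hcn
    have hΘn1 : Measurable[ℱ (n + 1)] (Θ (n + 1)) := by
      rw [funext (hΘ n)]
      exact (((hgn.const_mul 2).const_sub 1).smul hΘn).add ((hgn.const_mul 2).smul (hz n))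
    refine ⟨hΘn1, ?_⟩
    simp only [Nat.count_succ]
    exact hcn.add (Measurable.ite (hR n hΘn hΘn1) measurable_const measurable_const)

end Batches

/-! ### Convergence of the adaptive scheme -/

/-- Convergence of SGD with learning rates that are reduced whenever the test loss increases.
Sequences written with indices `1, 2, 3, …` are functions on `ℕ` that are only constrained on
indices `n ≥ 1`. -/
theorem theorem1p1 (d : ℕ) (hd : 1 ≤ d) (a b : ℝ) (hab : a < b)
    {Ω : Type*} [MeasurableSpace Ω] (P : Measure Ω) [IsProbabilityMeasure P]
    -- the i.i.d. data in the box `[a,b]^d`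
    (X : ℤ → ℤ → Ω → EuclideanSpace ℝ (Fin d))
    (hX_meas : ∀ n m, Measurable (X n m))
    (hX_mem : ∀ n m ω i, X n m ω i ∈ Set.Icc a b)
    (hX_indep : iIndepFun (fun (p : ℤ × ℤ) (ω : Ω) => X p.1 p.2 ω) P)
    (hX_ident : ∀ n m, IdentDistrib (X n m) (X 0 0) P P)
    (hX_supp : ∀ x : EuclideanSpace ℝ (Fin d), (∀ i, x i ∈ Set.Icc a b) →
      ∀ ε ∈ Set.Ioo (0 : ℝ) 1, 0 < P {ω | ‖X 0 0 ω - x‖ < ε})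
    -- the loss
    (l : EuclideanSpace ℝ (Fin d) → EuclideanSpace ℝ (Fin d) → ℝ)
    (hl : ∀ θ x, l θ x = ‖θ - x‖ ^ 2)
    -- the sizes of the training and of the test batches
    (M M' : ℕ) (hM : 1 ≤ M) (hM' : 1 ≤ M')
    -- the SGD process and the step sizes
    (Θ : ℕ → Ω → EuclideanSpace ℝ (Fin d)) (γ : ℕ → Ω → ℝ)
    (hΘ_meas : ∀ n, Measurable (Θ n)) (hγ_meas : ∀ n, 1 ≤ n → Measurable (γ n))
    (hΘ : ∀ n, 1 ≤ n → ∀ ω, Θ n ω = Θ (n - 1) ω - (γ n ω / (M : ℝ)) •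
      ∑ m ∈ Finset.Icc 1 M, gradient (fun θ => l θ (X n (m : ℤ) ω)) (Θ (n - 1) ω))
    (h_indep : IndepFun (fun (ω : Ω) (p : ℤ × ℤ) => X p.1 p.2 ω) (Θ 0) P)
    (hΘ_int : Integrable (fun ω => ‖Θ 0 ω‖ ^ 2) P)
    -- the admissible step sizes
    (ν : ℕ → ℝ) (hν_mem : ∀ n, 1 ≤ n → ν n ∈ Set.Ioo (0 : ℝ) 1)
    (hν_anti : StrictAntiOn ν (Set.Ici 1))
    (hν_sum : Tendsto (fun n : ℕ => ∑ k ∈ Finset.Icc 1 n, ν k) atTop atTop)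
    (hν_lim : Tendsto ν atTop (𝓝 0))
    -- the adaptive choice of the step sizes
    (hγ_one : ∀ ω, γ 1 ω = ν 1)
    (hγ_keep : ∀ n, 1 ≤ n → ∀ ω,
      ∑ m ∈ Finset.Icc 1 M', l (Θ n ω) (X n (-(m : ℤ)) ω) ≤
        ∑ m ∈ Finset.Icc 1 M', l (Θ (n - 1) ω) (X n (-(m : ℤ)) ω) →
      γ (n + 1) ω = γ n ω)
    (hγ_reduce : ∀ n, 1 ≤ n → ∀ ω,
      ∑ m ∈ Finset.Icc 1 M', l (Θ n ω) (X n (-(m : ℤ)) ω) >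
        ∑ m ∈ Finset.Icc 1 M', l (Θ (n - 1) ω) (X n (-(m : ℤ)) ω) →
      IsGreatest (Set.Ioo 0 (γ n ω) ∩ ν '' Set.Ici 1) (γ (n + 1) ω))
    -- the first index at which the accumulated step sizes reach `t`
    (N : ℝ → Ω → ℕ)
    (hN : ∀ t, 0 ≤ t → ∀ ω, N t ω = sInf {n : ℕ | t ≤ ∑ k ∈ Finset.Icc 1 n, γ k ω}) :
    (∀ t, 0 ≤ t → Integrable (fun ω => ‖Θ (N t ω) ω - ∫ ω', X 1 1 ω' ∂P‖) P) ∧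
    Tendsto (fun t : ℝ => ∫ ω, ‖Θ (N t ω) ω - ∫ ω', X 1 1 ω' ∂P‖ ∂P) atTop (𝓝 0) := by
  classical
  have hM0 : (0 : ℝ) < M := by exact_mod_cast hM
  have hν_pos : ∀ n, 1 ≤ n → 0 < ν n := fun n hn => (hν_mem n hn).1
  set μ := ∫ ω', X 1 1 ω' ∂P
  set z : ℕ → Ω → EuclideanSpace ℝ (Fin d) := fun n ω =>
    (M : ℝ)⁻¹ • ∑ m ∈ Finset.Icc 1 M, X ((n + 1 : ℕ) : ℤ) (m : ℤ) ω with hz_def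
  -- `R ω n`: the test loss increases in the step from `n` to `n + 1`
  set R : Ω → ℕ → Prop := fun ω n =>
    ∑ m ∈ Finset.Icc 1 M', l (Θ n ω) (X ((n + 1 : ℕ) : ℤ) (-(m : ℤ)) ω) <
      ∑ m ∈ Finset.Icc 1 M', l (Θ (n + 1) ω) (X ((n + 1 : ℕ) : ℤ) (-(m : ℤ)) ω) with hR_def
  set g : ℕ → Ω → ℝ := fun n ω => ν (Nat.count (R ω) n + 1) with hg_def
  have hγg : ∀ ω n, γ (n + 1) ω = g n ω := fun ω n =>
    stepSize_eq_count (R := R ω) (γ := fun k => γ k ω) hν_pos hν_anti (hγ_one ω)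
      (fun k hk => hγ_keep (k + 1) (by omega) ω (not_lt.1 hk))
      (fun k hk => hγ_reduce (k + 1) (by omega) ω hk) n
  have hg0 : ∀ n ω, 0 < g n ω := fun n ω => hν_pos _ (by omega)
  have hgq : ∀ n ω, g n ω ≤ ν 1 := fun n ω =>
    hν_anti.antitoneOn (by simp) (by simp) (by omega)
  have hg1 : ∀ n ω, g n ω < 1 := fun n ω => (hgq n ω).trans_lt (hν_mem 1 le_rfl).2
  have hΘz : ∀ n ω, Θ (n + 1) ω = (1 - 2 * g n ω) • Θ n ω + (2 * g n ω) • z n ω := by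
    intro n ω
    rw [hΘ (n + 1) (by omega) ω, hγg]
    simp only [hl, gradient_norm_sub_sq, Nat.add_sub_cancel]
    rw [← Finset.smul_sum, Finset.sum_sub_distrib, Finset.sum_const, Nat.card_Icc,
      Nat.add_sub_cancel, ← Nat.cast_smul_eq_nsmul ℝ, hz_def]
    have h1 : g n ω / M * M = g n ω := div_mul_cancel₀ _ hM0.ne'
    have h2 : g n ω / M = g n ω * (M : ℝ)⁻¹ := div_eq_mul_inv _ _
    simp only [smul_sub, smul_smul]
    rw [show g n ω / M * (2 * (M : ℝ)) = 2 * g n ω by linear_combination 2 * h1, h2]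
    module
  have hsumγ : ∀ ω n, ∑ k ∈ Finset.Icc 1 n, γ k ω = ∑ i ∈ Finset.range n, g i ω := by
    intro ω n
    induction n with
    | zero => simp
    | succ n ih => rw [Finset.sum_Icc_succ_top (by omega), Finset.sum_range_succ, ih, hγg]
  have hS : ∀ ω, Tendsto (fun n => ∑ i ∈ Finset.range n, g i ω) atTop atTop := fun ω =>
    tendsto_sum_stepSize hν_pos hν_anti hν_sum
  have hNiff : ∀ t, 0 ≤ t → ∀ ω n, N t ω ≤ n ↔ t ≤ ∑ i ∈ Finset.range n, g i ω := by
    intro t ht ω n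
    have hmono : Monotone fun n => ∑ i ∈ Finset.range n, g i ω := monotone_nat_of_le_succ
      fun k => by rw [Finset.sum_range_succ]; linarith [hg0 k ω]
    rw [hN t ht ω]
    simp only [hsumγ]
    have hne : {n : ℕ | t ≤ ∑ i ∈ Finset.range n, g i ω}.Nonempty :=
      ((hS ω).eventually_ge_atTop t).exists
    exact ⟨fun h => (Nat.sInf_mem hne : t ≤ _).trans (hmono h), fun h => Nat.sInf_le h⟩
  -- boundedness of the data
  set x : EuclideanSpace ℝ (Fin d) := WithLp.toLp 2 fun _ => a
  set y : EuclideanSpace ℝ (Fin d) := WithLp.toLp 2 fun _ => b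
  have hx_mem : ∀ i, x i ∈ Set.Icc a b := fun i => ⟨le_rfl, hab.le⟩
  have hy_mem : ∀ i, y i ∈ Set.Icc a b := fun i => ⟨hab.le, le_rfl⟩
  have hxy : x ≠ y := fun h => hab.ne (congrArg (fun v : EuclideanSpace ℝ (Fin d) => v ⟨0, hd⟩) h)
  set K₀ := √(d * (b - a) ^ 2)
  have hzx : ∀ n ω, ‖z n ω - x‖ ≤ K₀ := fun n ω =>
    norm_smul_sum_sub_le hM fun m _ => norm_sub_le_of_mem_box (hX_mem _ _ ω) hx_mem
  -- the step sizes tend to zero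
  have hlim : ∀ᵐ ω ∂P, Tendsto (fun n => g n ω) atTop (𝓝 0) := by
    filter_upwards [ae_frequently_pattern hX_meas hX_indep hX_ident (hX_supp x hx_mem)
      (hX_supp y hy_mem) M M'] with ω hω
    suffices hR : ∃ᶠ n in atTop, R ω n from
      hν_lim.comp ((tendsto_add_atTop_nat 1).comp (tendsto_count_of_frequently hR))
    intro hnot
    obtain ⟨n₀, hn₀⟩ := eventually_atTop.1 hnot
    have hconst : ∀ n ≥ n₀, g n ω = g n₀ ω := fun n hn => by
      induction n, hn using Nat.le_induction with
      | base => rfl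
      | succ n hn ih => rw [← ih, hg_def]; simp only [Nat.count_succ, if_neg (hn₀ n hn), add_zero]
    obtain ⟨m, r, hmr⟩ := exists_block_forcing_increase (θ := fun n => Θ n ω)
      (z := fun n => z n ω) (n₀ := n₀) (hg0 n₀ ω) (hg1 n₀ ω) hxy (fun n => hzx n ω)
      (fun n hn => by rw [hΘz, hconst n hn])
    obtain ⟨j, ⟨hj1, hj2, hj3⟩, hj⟩ := ((hω m r).and_eventually (eventually_ge_atTop n₀)).exists
    have hb : n₀ ≤ j * (r + 1) := hj.trans (Nat.le_mul_of_pos_right j (by omega))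
    have hinc := hmr (j * (r + 1)) hb
      (fun k hk => norm_smul_sum_sub_le hM fun i hi => hj1 k hk i hi)
      (norm_smul_sum_sub_le hM fun i hi => hj2 i hi)
    refine hn₀ (j * (r + 1) + r) (by omega) ?_
    simp only [hR_def, hl]
    refine Finset.sum_lt_sum_of_nonempty (Finset.nonempty_Icc.2 hM') fun i hi => ?_
    have := hinc _ (hj3 i hi)
    gcongr
  -- the past up to and including row `n`
  set T : ℕ → Finset (ℤ × ℤ) := fun n =>
    Finset.Icc 1 (n : ℤ) ×ˢ Finset.Icc (-(M' : ℤ)) M with hT_def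
  have hT : Monotone T := fun m n hmn => Finset.product_subset_product_left
    (Finset.Icc_subset_Icc_right (by exact_mod_cast hmn))
  set Xp : ℤ × ℤ → Ω → EuclideanSpace ℝ (Fin d) := fun p ω => X p.1 p.2 ω
  have hXp : ∀ p, Measurable (Xp p) := fun p => hX_meas p.1 p.2
  set ℱ := pastFiltration (Θ 0) Xp T hT (hΘ_meas 0) hXp
  have hXpast : ∀ (n : ℕ) (m : ℤ), -(M' : ℤ) ≤ m → m ≤ M →
      Measurable[ℱ (n + 1)] (X ((n + 1 : ℕ) : ℤ) m) := fun n m h1 h2 =>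
    measurable_pastFiltration hT (hΘ_meas 0) hXp (i := (((n + 1 : ℕ) : ℤ), m))
      (Finset.mem_product.2 ⟨Finset.mem_Icc.2 ⟨by push_cast; omega, le_rfl⟩,
        Finset.mem_Icc.2 ⟨h1, h2⟩⟩)
  have hzpast : ∀ n, Measurable[ℱ (n + 1)] (z n) := fun n =>
    measurable_batchMean fun m hm => hXpast n (m : ℤ) (by omega)
      (by have := (Finset.mem_Icc.1 hm).2; omega)
  have hadapted : ∀ n, Measurable[ℱ n] (Θ n) ∧ Measurable[ℱ n] fun ω => Nat.count (R ω) n := by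
    refine measurable_iterate_and_count (measurable_initial_pastFiltration hT (hΘ_meas 0) hXp 0)
      hzpast hΘz fun n h1 h2 => ?_
    have htest : ∀ m ∈ Finset.Icc 1 M', Measurable[ℱ (n + 1)]
        (X ((n + 1 : ℕ) : ℤ) (-(m : ℤ))) := fun m hm =>
      hXpast n (-(m : ℤ)) (by have := (Finset.mem_Icc.1 hm).2; omega) (by omega)
    simp only [hR_def, hl]
    exact measurableSet_lt (measurable_sum_norm_sub_sq h1 htest)
      (measurable_sum_norm_sub_sq h2 htest)
  -- the noise is independent of the past and centred
  have hnow : ∀ n, Indep (ℱ n) (MeasurableSpace.comap (fun ω => z n ω - μ) inferInstance) P := by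
    intro n
    refine indep_pastFiltration hT (hΘ_meas 0) hXp hX_indep h_indep
      (T' := {((n + 1 : ℕ) : ℤ)} ×ˢ Finset.Icc 1 (M : ℤ)) ?_ ?_
    · rw [Finset.disjoint_left]
      rintro ⟨i, k⟩ h1 h2
      simp only [hT_def, Finset.mem_product, Finset.mem_Icc, Finset.mem_singleton] at h1 h2
      have := h1.1.2
      rw [h2.1] at this
      push_cast at this
      omega
    · refine (measurable_batchMean fun m hm => ?_).sub_const μ
      have hm' : (((n + 1 : ℕ) : ℤ), (m : ℤ)) ∈
          ({((n + 1 : ℕ) : ℤ)} ×ˢ Finset.Icc 1 (M : ℤ) : Finset (ℤ × ℤ)) := by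
        have := Finset.mem_Icc.1 hm
        simp only [Finset.mem_product, Finset.mem_singleton, Finset.mem_Icc, true_and]
        omega
      exact measurable_comap_restrict (X := Xp) hm'
  have hXint : ∀ i k, Integrable (X i k) P := fun i k => by
    refine Integrable.of_bound (hX_meas i k).aestronglyMeasurable (K₀ + ‖x‖)
      (Eventually.of_forall fun ω => ?_)
    have h1 := norm_sub_le_of_mem_box (hX_mem i k ω) hx_mem
    have h2 := norm_le_norm_sub_add (X i k ω) x
    linarith
  have hXmean : ∀ i k, ∫ ω, X i k ω ∂P = μ := fun i k =>
    (hX_ident i k).integral_eq.trans (hX_ident 1 1).integral_eq.symm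
  have hzm : ∀ n, Measurable (z n) := fun n => (hzpast n).mono (ℱ.le _) le_rfl
  have hξ0 : ∀ n, ∫ ω, (z n ω - μ) ∂P = 0 := fun n =>
    integral_batchMean_sub_eq_zero hM (fun m => hXint _ _) fun m => hXmean _ _
  have hΘ2 : MemLp (fun ω => ‖Θ 0 ω‖) 2 P :=
    (memLp_two_iff_integrable_sq (hΘ_meas 0).norm.aestronglyMeasurable).2 hΘ_int
  have hD0 : Integrable (fun ω => ‖Θ 0 ω - μ‖ ^ 2) P :=
    (((memLp_norm_iff (hΘ_meas 0).aestronglyMeasurable).1 hΘ2).sub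
      (memLp_const μ)).norm.integrable_sq
  exact tendsto_integral_norm_stopped (ℱ := ℱ) (D := fun n ω => Θ n ω - μ)
    (ξ := fun n ω => z n ω - μ) (g := g) (q := ν 1) (K := K₀ + ‖x - μ‖) (hν_mem 1 le_rfl).2
    (fun n => (hadapted n).1.sub_const μ)
    (fun n => (measurable_from_nat (f := fun k => ν (k + 1))).comp (hadapted n).2)
    (fun n => (hzm n).sub_const μ) hnow hg0 hgq
    (fun n ω => (norm_sub_le_norm_sub_add_norm_sub _ x _).trans (by gcongr; exact hzx n ω)) hξ0
    (fun n ω => by rw [hΘz]; module) hD0 hS hlim N hNiff
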